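/- Let $d>1$ be an integer, $\delta\in(0,2)$ and $\delta\lambda\in(0,2]$, and let ${\cal D}_{\lambda,\delta}(r)=1-\left(\frac{r^\delta}{1+r^\delta}\right)^{\lambda}$, $r\ge 0$, be the Dagum function. Then, for every $z>0$, the integral below converges absolutely, and the isotropic spectral density $\widehat{\cal D}_{\delta,\lambda}$ of ${\cal D}_{\lambda,\delta}$ in $\mathbb{R}^d$ is given by $$\widehat{\cal D}_{\delta,\lambda}(z)=-\frac{z^{1-\frac d2}}{2^{\frac d2-1}\pi^{\frac d2+1}}\,\mathrm{Im}\int_0^\infty K_{\frac d2-1}(zt)\left(1-\frac{t^{\delta\lambda}e^{i\pi\delta\lambda/2}}{(1+e^{i\pi\delta/2}t^\delta)^{\lambda}}\right)t^{d/2}\,dt ,\qquad z>0,$$ where $K_\nu$ is the modified Bessel function of the second kind and the power is the principal one. Here the isotropic spectral density is the function given by $$\widehat{\cal D}_{\delta,\lambda}(z)=\frac{1}{(2\pi)^d}\int_{\mathbb{R}^d}e^{-i\boldsymbol z\cdot\boldsymbol r}{\cal D}_{\lambda,\delta}(\|\boldsymbol r\|)\,d\boldsymbol r=\frac{z^{1-\frac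 d2}}{(2\pi)^{d/2}}\int_0^\infty u^{d/2}J_{\frac d2-1}(uz)\,{\cal D}_{\lambda,\delta}(u)\,du,\qquad z=\|\boldsymbol z\|>0 .$$ Since ${\cal D}_{\lambda,\delta}(\|\cdot\|)$ is not integrable on $\mathbb{R}^d$, this is understood as follows: $\boldsymbol z\mapsto\widehat{\cal D}_{\delta,\lambda}(\|\boldsymbol z\|)$ is integrable on $\mathbb{R}^d$ and is the Fourier transform, with the above normalization, of ${\cal D}_{\lambda,\delta}(\|\cdot\|)$ in the sense of tempered distributions; and for every $z>0$ its value is that of the Hankel integral, taken as $\lim_{\varepsilon\to0^+}\int_0^\infty e^{-\varepsilon u^2}(\cdots)\,du$, which exists, and also as $\lim_{R\to\infty}\int_0^R(\cdots)\,du$ whenever this limit exists. -/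

import Mathlib

open Real Set Filter Topology MeasureTheory

noncomputable section

/-- The Dagum function `D(r) = 1 - (r^δ / (1 + r^δ))^λ`, for `r ≥ 0`. -/
def dagum (lam δ r : ℝ) : ℝ :=
  1 - (r ^ δ / (1 + r ^ δ)) ^ lam

/-- The Bessel function of the first kind, real order and argument `x ≥ 0`. -/
def besselJ (ν x : ℝ) : ℝ :=
  ∑' k : ℕ, (-1) ^ k / ((k.factorial : ℝ) * Real.Gamma (k + ν + 1)) * (x / 2) ^ (2 * (k : ℝ) + ν)

/-- The modified Bessel function of the second kind, real order and argument `x > 0`. -/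
def besselK (ν x : ℝ) : ℝ :=
  ∫ s in Ioi (0 : ℝ), Real.exp (-(x * Real.cosh s)) * Real.cosh (ν * s)

/-- The normalised integrand `z^{1-d/2} / (2π)^{d/2} * u^{d/2} J_{d/2-1}(uz) φ(u)` of the
`d`-dimensional Hankel transform of `φ` at `z > 0`. -/
def hankelIntegrand (d : ℕ) (φ : ℝ → ℝ) (z u : ℝ) : ℝ :=
  z ^ (1 - (d : ℝ) / 2) / (2 * π) ^ ((d : ℝ) / 2) *
    (u ^ ((d : ℝ) / 2) * besselJ ((d : ℝ) / 2 - 1) (u * z) * φ u)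

/-- The angular-frequency Fourier transform `(2π)^{-d} ∫ e^{-i z·r} ψ(z) dz`. -/
def angularFourier (d : ℕ) (ψ : EuclideanSpace ℝ (Fin d) → ℂ) (r : EuclideanSpace ℝ (Fin d)) :
    ℂ :=
  (1 / (2 * (π : ℂ)) ^ d) *
    ∫ z : EuclideanSpace ℝ (Fin d), Complex.exp (-(Complex.I * (inner ℝ z r : ℝ))) * ψ z

/-- `f` (a function of `z = ‖z‖ > 0`) is the isotropic spectral density in `ℝ^d` of `φ`, where
`φ(‖·‖)` is bounded but need not be integrable.

* `f(‖·‖)` is integrable on `ℝ^d`, and it is the Fourier transform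
  `(2π)^{-d} ∫ e^{-i z·r} φ(‖r‖) dr` in the sense of tempered distributions;
* for every `z > 0`, `f z` is the value at `z` of the Hankel transform of `φ`: always as a
  Gaussian-summed integral, and as the improper integral `lim_{R → ∞} ∫_0^R` whenever this
  limit exists. -/
structure IsIsotropicSpectralDensity (d : ℕ) (φ f : ℝ → ℝ) : Prop where
  integrable : Integrable (fun z : EuclideanSpace ℝ (Fin d) => f ‖z‖)
  fourier : ∀ ψ : SchwartzMap (EuclideanSpace ℝ (Fin d)) ℂ,
    ∫ z : EuclideanSpace ℝ (Fin d), (f ‖z‖ : ℂ) * ψ z =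
      ∫ r : EuclideanSpace ℝ (Fin d), (φ ‖r‖ : ℂ) * angularFourier d ψ r
  hankel_summed : ∀ z : ℝ, 0 < z →
    Tendsto (fun ε : ℝ => ∫ u in Ioi (0 : ℝ), Real.exp (-(ε * u ^ 2)) * hankelIntegrand d φ z u)
      (𝓝[>] 0) (𝓝 (f z))
  hankel_improper : ∀ z : ℝ, 0 < z → ∀ l : ℝ,
    Tendsto (fun R : ℝ => ∫ u in (0 : ℝ)..R, hankelIntegrand d φ z u) atTop (𝓝 l) → f z = l

/-- The integrand
`K_{d/2-1}(zt) (1 - t^{δλ} e^{iπδλ/2} / (1 + e^{iπδ/2} t^δ)^λ) t^{d/2}`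
(principal power of a complex number with positive imaginary part when `t > 0`). -/
def rotatedIntegrand (d : ℕ) (lam δ z t : ℝ) : ℂ :=
  (besselK ((d : ℝ) / 2 - 1) (z * t) : ℂ) *
    (1 - ((t ^ (δ * lam) : ℝ) : ℂ) * Complex.exp (Complex.I * π * δ * lam / 2) /
      (1 + Complex.exp (Complex.I * π * δ / 2) * ((t ^ δ : ℝ) : ℂ)) ^ (lam : ℂ)) *
    ((t ^ ((d : ℝ) / 2) : ℝ) : ℂ)

end

/-! The Dagum function is a positive mixture of Gaussians, $D(r)=\int e^{-sr^2}\,d\kappa(s)$ with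
$\kappa$ finite on $(0,\infty)$. For one Gaussian every required property is explicit, the spectral
density being $(4\pi s)^{-d/2}e^{-z^2/(4s)}$; finiteness and positivity of $\kappa$ carry the
properties over to the mixture (`isIsotropicSpectralDensity_of_mixture`).

The measure comes from complex analysis. In the variable $\zeta=\log r$, $D$ extends to $F$, bounded
and holomorphic around the closed strip $|\mathrm{Im}\,\zeta|\le\pi/2$ because $\delta<2$, and
$\mathrm{Im}\,F\le 0$ on the line $\mathrm{Im}\,\zeta=\pi/2$ because $\delta\lambda\le 2$. Cauchy's
theorem gives $D(r)=\frac2\pi\int_0^\infty \frac{t\,g(t)}{t^2+r^2}\,dt$ with $g=-\mathrm{Im}\,F(\log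
t+i\pi/2)\ge 0$ (`dagum_eq_integral_dagumBoundary`). Expanding $1/(t^2+r^2)=\int_0^\infty
e^{-s(t^2+r^2)}\,ds$ produces $\kappa$, of mass at most $1$ since $D\le 1$.

The spectral density is thus $\int(4\pi s)^{-d/2}e^{-z^2/(4s)}\,d\kappa(s)$. Doing the $s$-integral
before the $t$-integral turns the Gaussian into $K_{d/2-1}(zt)$ (`integral_exp_mul_heatKernel`),
which leaves the stated formula. The improper Hankel integral, when it converges, agrees with the
Gaussian-summed one by an Abelian theorem. -/

/-! ### Weber's integral and the Hankel transform of a Gaussian. -/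

/-- A series of integrable functions with summable `L¹` norms has an integrable sum. -/
theorem integrable_tsum_of_summable_integral_norm {α : Type*} {m : MeasurableSpace α}
    {μ : Measure α} {F : ℕ → α → ℝ} (hF_int : ∀ i, Integrable (F i) μ)
    (hF_sum : Summable fun i => ∫ a, ‖F i a‖ ∂μ) : Integrable (fun a => ∑' i, F i a) μ := by
  have hlin (i : ℕ) : ∫⁻ a, ‖F i a‖ₑ ∂μ = ENNReal.ofReal (∫ a, ‖F i a‖ ∂μ) :=
    (ofReal_integral_norm_eq_lintegral_enorm (hF_int i)).symm
  have hsum : ∫⁻ a, ∑' i, ‖F i a‖ₑ ∂μ ≠ ⊤ := by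
    rw [lintegral_tsum fun i => (hF_int i).1.enorm]
    simp only [hlin]
    exact hF_sum.tsum_ofReal_ne_top
  have hae : ∀ᵐ a ∂μ, Summable fun i => F i a := by
    filter_upwards [ae_lt_top' (AEMeasurable.tsum fun i => (hF_int i).1.enorm) hsum]
      with a ha
    exact (ENNReal.tsum_coe_ne_top_iff_summable_coe.mp ha.ne).of_norm
  refine ⟨aestronglyMeasurable_of_tendsto_ae atTop
    (f := fun n a => ∑ i ∈ Finset.range n, F i a)
    (fun n => Finset.aestronglyMeasurable_fun_sum _ fun i _ => (hF_int i).1) ?_, ?_⟩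
  · filter_upwards [hae] with a ha using ha.hasSum.tendsto_sum_nat
  · refine (lintegral_mono_ae ?_).trans_lt hsum.lt_top
    filter_upwards [hae] with a ha
    exact enorm_tsum_le_tsum_enorm

/-- The terms of the series for `u ^ (ν + 1) * J_ν (u z) * exp (-(p * u ^ 2))`. -/
theorem besselJ_series_term_eq {ν z u : ℝ} (hz : 0 < z) (hu : 0 < u) (p : ℝ) (k : ℕ) :
    exp (-(p * u ^ 2)) * (u ^ (ν + 1) * ((-1) ^ k / ((k.factorial : ℝ) * Real.Gamma (k + ν + 1)) *
      (u * z / 2) ^ (2 * (k : ℝ) + ν))) =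
    (-1) ^ k / ((k.factorial : ℝ) * Real.Gamma (k + ν + 1)) * (z / 2) ^ (2 * (k : ℝ) + ν) *
      (u ^ (2 * (k : ℝ) + 2 * ν + 1) * exp (-p * u ^ (2 : ℝ))) := by
  have h1 : (u * z / 2) ^ (2 * (k : ℝ) + ν) =
      u ^ (2 * (k : ℝ) + ν) * (z / 2) ^ (2 * (k : ℝ) + ν) := by
    rw [mul_div_assoc, mul_rpow hu.le (by positivity)]
  have h2 : u ^ (2 * (k : ℝ) + 2 * ν + 1) = u ^ (ν + 1) * u ^ (2 * (k : ℝ) + ν) := by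
    rw [← rpow_add hu]; ring_nf
  have h3 : u ^ (2 : ℝ) = u ^ 2 := by norm_cast
  rw [h1, h2, h3, neg_mul]
  ring

/-- The Gaussian moment produces exactly the Gamma factor of the Bessel coefficient, so an
exponential series remains. The sign is left out so that the identity serves both the $L^1$ norms
and the integrals themselves. -/
theorem integral_besselJ_series_term {ν z p : ℝ} (hν : 0 ≤ ν) (hz : 0 < z) (hp : 0 < p) (k : ℕ) :
    1 / ((k.factorial : ℝ) * Real.Gamma (k + ν + 1)) * (z / 2) ^ (2 * (k : ℝ) + ν) *
      ∫ u in Ioi (0 : ℝ), u ^ (2 * (k : ℝ) + 2 * ν + 1) * exp (-p * u ^ (2 : ℝ)) =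
    (z / 2) ^ ν / (2 * p ^ (ν + 1)) * ((z ^ 2 / (4 * p)) ^ k / k.factorial) := by
  rw [integral_rpow_mul_exp_neg_mul_rpow two_pos (by linarith [k.cast_nonneg (α := ℝ)]) hp]
  have hG : Real.Gamma (k + ν + 1) ≠ 0 := (Real.Gamma_pos_of_pos (by positivity)).ne'
  have e1 : (2 * (k : ℝ) + 2 * ν + 1 + 1) / 2 = k + ν + 1 := by ring
  have e2 : p ^ (-(2 * (k : ℝ) + 2 * ν + 1 + 1) / 2) = (p ^ (ν + 1) * p ^ k)⁻¹ := by
    rw [← rpow_natCast, ← rpow_add hp, ← rpow_neg hp.le]; ring_nf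
  have e3 : (z / 2) ^ (2 * (k : ℝ) + ν) = (z / 2) ^ ν * (z ^ 2 / 4) ^ k := by
    rw [show z ^ 2 / 4 = (z / 2) ^ (2 : ℝ) by norm_cast; ring, ← rpow_natCast, ← rpow_mul
      (by positivity), ← rpow_add (by positivity)]
    ring_nf
  rw [e1, e2, e3, ← div_div (z ^ 2) 4 p, div_pow (z ^ 2 / 4) p k]
  have := (rpow_pos_of_pos hp (ν + 1)).ne'
  field_simp

/-- Weber's first exponential integral, with absolute convergence. -/
theorem integrableOn_and_integral_exp_mul_besselJ {ν z p : ℝ} (hν : 0 ≤ ν) (hz : 0 < z)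
    (hp : 0 < p) :
    IntegrableOn (fun u => exp (-(p * u ^ 2)) * (u ^ (ν + 1) * besselJ ν (u * z))) (Ioi 0) ∧
    ∫ u in Ioi (0 : ℝ), exp (-(p * u ^ 2)) * (u ^ (ν + 1) * besselJ ν (u * z)) =
      (z / 2) ^ ν / (2 * p ^ (ν + 1)) * exp (-(z ^ 2 / (4 * p))) := by
  set F : ℕ → ℝ → ℝ := fun k u =>
    (-1) ^ k / ((k.factorial : ℝ) * Real.Gamma (k + ν + 1)) * (z / 2) ^ (2 * (k : ℝ) + ν) *
      (u ^ (2 * (k : ℝ) + 2 * ν + 1) * exp (-p * u ^ (2 : ℝ))) with hF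
  have hEq : ∀ u ∈ Ioi (0 : ℝ),
      exp (-(p * u ^ 2)) * (u ^ (ν + 1) * besselJ ν (u * z)) = ∑' k, F k u := by
    intro u hu
    rw [besselJ, ← tsum_mul_left, ← tsum_mul_left]
    exact tsum_congr fun k => besselJ_series_term_eq hz hu p k
  have hInt (k : ℕ) : IntegrableOn (F k) (Ioi 0) :=
    (integrableOn_rpow_mul_exp_neg_mul_rpow (by linarith [k.cast_nonneg (α := ℝ)]) two_pos
      hp).const_mul _
  have hnorm (k : ℕ) : ∫ u in Ioi (0 : ℝ), ‖F k u‖ =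
      (z / 2) ^ ν / (2 * p ^ (ν + 1)) * ((z ^ 2 / (4 * p)) ^ k / k.factorial) := by
    rw [← integral_besselJ_series_term hν hz hp k, ← integral_const_mul]
    refine setIntegral_congr_fun measurableSet_Ioi fun u hu => ?_
    have hu' : 0 < u := hu
    have hG : 0 < Real.Gamma (k + ν + 1) := Real.Gamma_pos_of_pos (by positivity)
    simp only [hF, norm_mul, norm_div, norm_pow, norm_neg, norm_one, one_pow, Real.norm_eq_abs]
    rw [abs_of_pos hG, abs_of_pos (by positivity : (0 : ℝ) < k.factorial),
      abs_of_pos (by positivity : 0 < (z / 2) ^ (2 * (k : ℝ) + ν)),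
      abs_of_pos (by positivity : 0 < u ^ (2 * (k : ℝ) + 2 * ν + 1)), abs_of_pos (exp_pos _)]
  have hval (k : ℕ) : ∫ u in Ioi (0 : ℝ), F k u =
      (z / 2) ^ ν / (2 * p ^ (ν + 1)) * ((-(z ^ 2 / (4 * p))) ^ k / k.factorial) := by
    rw [neg_pow, mul_div_assoc, mul_left_comm, ← integral_besselJ_series_term hν hz hp k, hF]
    simp only [integral_const_mul]
    ring
  have hsum : Summable fun k => ∫ u in Ioi (0 : ℝ), ‖F k u‖ := by
    simp only [hnorm]
    exact (Real.summable_pow_div_factorial _).mul_left _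
  constructor
  · exact IntegrableOn.congr_fun (integrable_tsum_of_summable_integral_norm hInt hsum)
      (fun u hu => (hEq u hu).symm) measurableSet_Ioi
  · rw [setIntegral_congr_fun measurableSet_Ioi hEq,
      ← integral_tsum_of_summable_integral_norm hInt hsum]
    simp only [hval]
    rw [tsum_mul_left, Real.exp_eq_exp_ℝ, NormedSpace.exp_eq_tsum_div]

/-- The isotropic Gaussian density `(4 π s)^{-d/2} exp (-z² / (4 s))`. -/
noncomputable def heatKernel (d : ℕ) (s z : ℝ) : ℝ :=
  (4 * π * s) ^ (-((d : ℝ) / 2)) * exp (-(z ^ 2 / (4 * s)))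

theorem heatKernel_nonneg (d : ℕ) {s : ℝ} (hs : 0 ≤ s) (z : ℝ) : 0 ≤ heatKernel d s z := by
  unfold heatKernel; positivity

/-- Weber's integral of order $d/2-1\ge 0$. The Gaussian stands outside `hankelIntegrand` because
its rate will be $s+\varepsilon$: mixture component and summation factor together. -/
theorem integrableOn_hankelIntegrand_gaussian {d : ℕ} (hd : 1 < d) {z p : ℝ} (hz : 0 < z)
    (hp : 0 < p) :
    IntegrableOn (fun u => exp (-(p * u ^ 2)) * hankelIntegrand d (fun _ => 1) z u) (Ioi 0) ∧
    ∫ u in Ioi (0 : ℝ), exp (-(p * u ^ 2)) * hankelIntegrand d (fun _ => 1) z u =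
      heatKernel d p z := by
  have hd' : (2 : ℝ) ≤ d := by exact_mod_cast hd
  obtain ⟨h1, h2⟩ := integrableOn_and_integral_exp_mul_besselJ (ν := (d : ℝ) / 2 - 1)
    (by linarith) hz hp
  have hEq : (fun u => exp (-(p * u ^ 2)) * hankelIntegrand d (fun _ => 1) z u) = fun u =>
      z ^ (1 - (d : ℝ) / 2) / (2 * π) ^ ((d : ℝ) / 2) *
      (exp (-(p * u ^ 2)) * (u ^ ((d : ℝ) / 2 - 1 + 1) * besselJ ((d : ℝ) / 2 - 1) (u * z))) := by
    funext u
    rw [hankelIntegrand, sub_add_cancel]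
    ring
  rw [hEq]
  refine ⟨h1.const_mul _, ?_⟩
  have h4 : (4 * π * p) ^ ((d : ℝ) / 2) =
      2 ^ ((d : ℝ) / 2) * (2 * π) ^ ((d : ℝ) / 2) * p ^ ((d : ℝ) / 2) := by
    rw [← mul_rpow (by positivity) (by positivity), ← mul_rpow (by positivity) hp.le]
    ring_nf
  rw [integral_const_mul, h2, heatKernel, sub_add_cancel, div_rpow hz.le two_pos.le,
    rpow_neg (by positivity), show 1 - (d : ℝ) / 2 = -((d : ℝ) / 2 - 1) by ring,
    rpow_neg hz.le, rpow_sub_one two_ne_zero, h4]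
  have := (rpow_pos_of_pos hz ((d : ℝ) / 2 - 1)).ne'
  field_simp

/-! ### An Abelian theorem for Gaussian summation. -/

/-- Writing the Gaussian as the tail of a density allows integration by parts through Fubini; at
$u=0$ it says that the density has mass $1$. -/
theorem integral_Ioi_mul_exp_neg_mul_sq {ε : ℝ} (hε : 0 < ε) {u : ℝ} (hu : 0 ≤ u) :
    IntegrableOn (fun v : ℝ => 2 * ε * v * exp (-(ε * v ^ 2))) (Ioi u) ∧
    ∫ v in Ioi u, 2 * ε * v * exp (-(ε * v ^ 2)) = exp (-(ε * u ^ 2)) := by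
  have hder : ∀ v ∈ Ici u, HasDerivAt (fun v : ℝ => -exp (-(ε * v ^ 2)))
      (2 * ε * v * exp (-(ε * v ^ 2))) v := fun v _ => by
    have := ((((hasDerivAt_pow 2 v).const_mul ε).neg).exp).neg
    convert! this using 1
    norm_num
    ring
  have hlim : Tendsto (fun v : ℝ => -exp (-(ε * v ^ 2))) atTop (𝓝 0) := by
    rw [← neg_zero]
    exact (tendsto_exp_neg_atTop_nhds_zero.comp
      ((tendsto_pow_atTop two_ne_zero).const_mul_atTop hε)).neg
  have hpos : ∀ v ∈ Ioi u, 0 ≤ 2 * ε * v * exp (-(ε * v ^ 2)) := fun v hv => by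
    have : 0 < v := hu.trans_lt hv
    positivity
  refine ⟨integrableOn_Ioi_deriv_of_nonneg' hder hpos hlim, ?_⟩
  rw [integral_Ioi_of_hasDerivAt_of_nonneg' hder hpos hlim]
  ring

/-- Gaussian summation of a convergent improper integral gives the same value. -/
theorem tendsto_integral_gaussian_mul_of_tendsto_intervalIntegral {h : ℝ → ℝ}
    (hint : ∀ ε : ℝ, 0 < ε → IntegrableOn (fun u => exp (-(ε * u ^ 2)) * h u) (Ioi 0)) {l : ℝ}
    (hl : Tendsto (fun R : ℝ => ∫ u in (0 : ℝ)..R, h u) atTop (𝓝 l)) :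
    Tendsto (fun ε : ℝ => ∫ u in Ioi (0 : ℝ), exp (-(ε * u ^ 2)) * h u) (𝓝[>] 0) (𝓝 l) := by
  have hmeas : AEStronglyMeasurable h (volume.restrict (Ioi 0)) := by
    have := (hint 1 one_pos).1.mul
      (Continuous.aestronglyMeasurable (f := fun u : ℝ => exp (1 * u ^ 2)) (by fun_prop))
    refine this.congr (ae_of_all _ fun u => ?_)
    simp only [Pi.mul_apply]
    rw [mul_right_comm, ← exp_add]
    simp
  have hloc (V : ℝ) : IntegrableOn h (Ioc 0 V) := by
    refine Integrable.mono' ((((hint 1 one_pos).mono_set Ioc_subset_Ioi_self).norm).const_mul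
      (exp (V ^ 2))) (hmeas.mono_set Ioc_subset_Ioi_self) ?_
    refine (ae_restrict_iff' measurableSet_Ioc).2 (ae_of_all _ fun u hu => ?_)
    rw [norm_mul, Real.norm_of_nonneg (exp_pos _).le, ← mul_assoc, ← exp_add]
    refine le_mul_of_one_le_left (norm_nonneg _) (one_le_exp ?_)
    nlinarith [hu.1, hu.2]
  -- Nothing is known about `h` on the negative axis; cutting it off there makes the primitive
  -- continuous on the whole line.
  set h₀ : ℝ → ℝ := (Ioi 0).indicator h with hh₀
  have hh₀int (a b : ℝ) : IntervalIntegrable h₀ volume a b := by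
    have key : ∀ a b : ℝ, IntegrableOn h₀ (Ioc a b) := fun a b => by
      rw [hh₀, IntegrableOn, integrable_indicator_iff measurableSet_Ioi, IntegrableOn,
        Measure.restrict_restrict measurableSet_Ioi]
      exact (hloc b).mono_set fun u hu => ⟨hu.1, hu.2.2⟩
    exact ⟨key a b, key b a⟩
  set Φ : ℝ → ℝ := fun v => ∫ u in (0 : ℝ)..v, h₀ u with hΦ
  have hΦc : Continuous Φ := intervalIntegral.continuous_primitive hh₀int 0
  have hΦeq (v : ℝ) (hv : 0 ≤ v) : Φ v = ∫ u in (0 : ℝ)..v, h u := by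
    simp only [hΦ]
    rw [intervalIntegral.integral_of_le hv, intervalIntegral.integral_of_le hv]
    exact setIntegral_congr_fun measurableSet_Ioc fun u hu => indicator_of_mem hu.1 h
  have hΦl : Tendsto Φ atTop (𝓝 l) :=
    hl.congr' ((eventually_ge_atTop 0).mono fun v hv => (hΦeq v hv).symm)
  obtain ⟨M, hM⟩ : ∃ M, ∀ v, 0 ≤ v → ‖Φ v‖ ≤ M := by
    obtain ⟨N, hN⟩ := eventually_atTop.1 (hΦl.norm.eventually (ge_mem_nhds (lt_add_one ‖l‖)))
    obtain ⟨C, hC⟩ := (isCompact_Icc (a := (0 : ℝ)) (b := N)).exists_bound_of_continuousOn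
      hΦc.continuousOn
    refine ⟨max C (‖l‖ + 1), fun v hv => ?_⟩
    rcases le_total v N with h' | h'
    · exact (hC v ⟨hv, h'⟩).trans (le_max_left _ _)
    · exact (hN v h').trans (le_max_right _ _)
  -- Integration by parts without differentiating `h`: Fubini on the triangle $0<u<v$.
  have hA (ε : ℝ) (hε : 0 < ε) : ∫ u in Ioi (0 : ℝ), exp (-(ε * u ^ 2)) * h u =
      ∫ v in Ioi (0 : ℝ), 2 * ε * v * exp (-(ε * v ^ 2)) * Φ v := by
    set K : ℝ → ℝ → ℝ := fun u v =>
      (Ioi u).indicator (fun v => h u * (2 * ε * v * exp (-(ε * v ^ 2)))) v with hK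
    have hKi (u : ℝ) (hu : 0 < u) (c : ℝ) : ∫ v in Ioi (0 : ℝ),
        (Ioi u).indicator (fun v => c * (2 * ε * v * exp (-(ε * v ^ 2)))) v =
        exp (-(ε * u ^ 2)) * c := by
      rw [integral_indicator measurableSet_Ioi, Measure.restrict_restrict measurableSet_Ioi,
        inter_eq_left.2 (Ioi_subset_Ioi hu.le), integral_const_mul,
        (integral_Ioi_mul_exp_neg_mul_sq hε hu.le).2,
        mul_comm]
    have hKint : Integrable (Function.uncurry K)
        ((volume.restrict (Ioi 0)).prod (volume.restrict (Ioi 0))) := by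
      have hKm : AEStronglyMeasurable (Function.uncurry K)
          ((volume.restrict (Ioi 0)).prod (volume.restrict (Ioi 0))) := by
        have hEq : Function.uncurry K = {q : ℝ × ℝ | q.1 < q.2}.indicator
            fun q => h q.1 * (2 * ε * q.2 * exp (-(ε * q.2 ^ 2))) := by
          ext ⟨u, v⟩
          simp [K, Function.uncurry, indicator]
        rw [hEq]
        refine AEStronglyMeasurable.indicator ?_
          (measurableSet_lt measurable_fst measurable_snd)
        exact hmeas.comp_fst.mul (Continuous.aestronglyMeasurable (by fun_prop))
      rw [integrable_prod_iff hKm]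
      constructor
      · refine (ae_restrict_iff' measurableSet_Ioi).2 (ae_of_all _ fun u hu => ?_)
        simp only [Function.uncurry, hK]
        rw [integrable_indicator_iff measurableSet_Ioi, IntegrableOn,
          Measure.restrict_restrict measurableSet_Ioi,
          inter_eq_left.2 (Ioi_subset_Ioi (le_of_lt hu))]
        exact (integral_Ioi_mul_exp_neg_mul_sq hε (le_of_lt hu)).1.const_mul _
      · refine (hint ε hε).norm.congr ?_
        refine (ae_restrict_iff' measurableSet_Ioi).2 (ae_of_all _ fun u hu => ?_)
        simp only [Function.uncurry, hK]
        rw [norm_mul, Real.norm_of_nonneg (exp_pos _).le, ← hKi u hu]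
        refine setIntegral_congr_fun measurableSet_Ioi fun v hv => ?_
        have hv' : 0 < v := hv
        simp only [norm_indicator_eq_indicator_norm, norm_mul]
        by_cases huv : v ∈ Ioi u
        · rw [indicator_of_mem huv, indicator_of_mem huv]
          simp only [Real.norm_eq_abs, abs_two, abs_of_pos hε, abs_of_pos hv', abs_exp]
        · rw [indicator_of_notMem huv, indicator_of_notMem huv]
    have hsw := integral_integral_swap hKint
    rw [setIntegral_congr_fun measurableSet_Ioi fun u hu => (hKi u hu (h u)).symm]
    refine hsw.trans (setIntegral_congr_fun measurableSet_Ioi fun v hv => ?_)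
    have hv' : 0 < v := hv
    have hEq : (fun u => K u v) =
        (Iio v).indicator fun u => 2 * ε * v * exp (-(ε * v ^ 2)) * h u := by
      ext u
      simp only [K, indicator, mem_Ioi, mem_Iio]
      split_ifs <;> ring
    simp only [hEq]
    rw [integral_indicator measurableSet_Iio, Measure.restrict_restrict measurableSet_Iio,
      integral_const_mul, hΦeq v hv'.le, intervalIntegral.integral_of_le hv'.le,
      integral_Ioc_eq_integral_Ioo, inter_comm, Ioi_inter_Iio]
  -- The substitution $v=w/\sqrt\varepsilon$ frees the weight of $\varepsilon$, so only the argument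
  -- of `Φ` moves, to infinity.
  have hB (ε : ℝ) (hε : 0 < ε) : ∫ u in Ioi (0 : ℝ), exp (-(ε * u ^ 2)) * h u =
      ∫ w in Ioi (0 : ℝ), 2 * 1 * w * exp (-(1 * w ^ 2)) * Φ ((√ε)⁻¹ * w) := by
    have hs : 0 < √ε := sqrt_pos.2 hε
    have hs2 : √ε ^ 2 = ε := sq_sqrt hε.le
    have := integral_comp_mul_left_Ioi'
      (fun v => 2 * ε * v * exp (-(ε * v ^ 2)) * Φ v) 0 (inv_pos.2 hs)
    rw [hA ε hε]
    rw [mul_zero] at this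
    rw [← this, smul_eq_mul, ← integral_const_mul]
    congr 1
    ext w
    have e1 : ε * ((√ε)⁻¹ * w) ^ 2 = w ^ 2 := by
      rw [mul_pow, inv_pow, hs2]; field_simp
    have e2 : (√ε)⁻¹ * (2 * ε * ((√ε)⁻¹ * w)) = 2 * w := by
      nth_rw 2 [← hs2]; field_simp
    rw [e1, one_mul, mul_one, ← mul_assoc, ← mul_assoc, e2]
  have hmass := integral_Ioi_mul_exp_neg_mul_sq one_pos (le_refl (0 : ℝ))
  have hlim : Tendsto (fun ε : ℝ => ∫ w in Ioi (0 : ℝ),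
      2 * 1 * w * exp (-(1 * w ^ 2)) * Φ ((√ε)⁻¹ * w)) (𝓝[>] 0)
      (𝓝 (∫ w in Ioi (0 : ℝ), 2 * 1 * w * exp (-(1 * w ^ 2)) * l)) := by
    refine tendsto_integral_filter_of_dominated_convergence
      (fun w => 2 * 1 * w * exp (-(1 * w ^ 2)) * M) ?_ ?_ (hmass.1.mul_const M) ?_
    · refine Eventually.of_forall fun ε => Continuous.aestronglyMeasurable ?_
      exact (by fun_prop : Continuous fun w : ℝ => 2 * 1 * w * exp (-(1 * w ^ 2))).mul
        (hΦc.comp (by fun_prop))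
    · refine eventually_mem_nhdsWithin.mono fun ε hε => ?_
      refine (ae_restrict_iff' measurableSet_Ioi).2 (ae_of_all _ fun w hw => ?_)
      have hw' : 0 < w := hw
      have hpos : 0 ≤ 2 * 1 * w * exp (-(1 * w ^ 2)) := by positivity
      rw [norm_mul, Real.norm_of_nonneg hpos]
      exact mul_le_mul_of_nonneg_left (hM _ (by positivity)) hpos
    · refine (ae_restrict_iff' measurableSet_Ioi).2 (ae_of_all _ fun w hw => ?_)
      refine (hΦl.comp ?_).const_mul _
      have h1 : Tendsto (fun ε : ℝ => √ε) (𝓝[>] 0) (𝓝[>] 0) := by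
        refine tendsto_nhdsWithin_iff.2 ⟨?_, eventually_mem_nhdsWithin.mono fun ε hε =>
          sqrt_pos.2 hε⟩
        have := (continuous_sqrt.tendsto 0).mono_left (nhdsWithin_le_nhds (s := Ioi (0 : ℝ)))
        rwa [sqrt_zero] at this
      exact (tendsto_inv_nhdsGT_zero.comp h1).atTop_mul_const hw
  rw [integral_mul_const, hmass.2] at hlim
  simp only [ne_eq, OfNat.ofNat_ne_zero, not_false_eq_true, zero_pow, mul_zero, neg_zero,
    exp_zero, one_mul] at hlim
  refine hlim.congr' (eventually_mem_nhdsWithin.mono fun ε hε => ?_)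
  have := hB ε hε
  simp only [one_mul] at this
  exact this.symm

/-! ### Bounds and Fourier transform of the Gaussian density. -/

/-- With $a=d/2$ and $x=z^2/(4s)$, the kernel is a constant times $x^ae^{-x}$, and $x/a\le e^{x/a}$
gives $x^ae^{-x}\le a^a$. The bound does not depend on $s$, so it dominates against any finite
measure. -/
theorem heatKernel_le {d : ℕ} (hd : 0 < d) {s z : ℝ} (hs : 0 < s) (hz : 0 < z) :
    heatKernel d s z ≤ ((d : ℝ) / 2 / (π * z ^ 2)) ^ ((d : ℝ) / 2) := by
  set a : ℝ := (d : ℝ) / 2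
  have ha : 0 < a := by positivity
  set x : ℝ := z ^ 2 / (4 * s) with hx
  have hx0 : 0 < x := by positivity
  have h1 : (4 * π * s) ^ (-a) = (x / (π * z ^ 2)) ^ a := by
    rw [rpow_neg (by positivity), ← inv_rpow (by positivity)]
    congr 1
    rw [hx]; field_simp
  have h2 : x ^ a ≤ a ^ a * exp x := by
    have : x ≤ a * exp (x / a) := by
      have := add_one_le_exp (x / a)
      calc x = a * (x / a) := by field_simp
        _ ≤ a * exp (x / a) := by gcongr; linarith
    calc x ^ a ≤ (a * exp (x / a)) ^ a := rpow_le_rpow hx0.le this ha.le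
      _ = a ^ a * exp x := by
        rw [mul_rpow ha.le (exp_pos _).le, ← exp_mul, div_mul_cancel₀ _ ha.ne']
  unfold heatKernel
  change (4 * π * s) ^ (-a) * exp (-x) ≤ _
  rw [h1, div_rpow hx0.le (by positivity), div_rpow ha.le (by positivity), exp_neg,
    div_mul_eq_mul_div]
  gcongr
  rw [← div_eq_mul_inv, div_le_iff₀ (exp_pos _)]
  exact h2

theorem measurable_heatKernel (d : ℕ) : Measurable fun q : ℝ × ℝ => heatKernel d q.1 q.2 := by
  unfold heatKernel; fun_prop

theorem integral_heatKernel_norm (d : ℕ) {s : ℝ} (hs : 0 < s) :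
    Integrable (fun z : EuclideanSpace ℝ (Fin d) => heatKernel d s ‖z‖) ∧
    ∫ z : EuclideanSpace ℝ (Fin d), heatKernel d s ‖z‖ = 1 := by
  have h : ∫ z : EuclideanSpace ℝ (Fin d), heatKernel d s ‖z‖ = 1 := by
    have hb : 0 < 1 / (4 * s) := by positivity
    have := GaussianFourier.integral_rexp_neg_mul_sq_norm (V := EuclideanSpace ℝ (Fin d)) hb
    simp only [heatKernel, integral_const_mul]
    simp only [finrank_euclideanSpace, Fintype.card_fin] at this
    rw [show (fun z : EuclideanSpace ℝ (Fin d) => exp (-(‖z‖ ^ 2 / (4 * s)))) =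
      fun z => exp (-(1 / (4 * s)) * ‖z‖ ^ 2) by ext z; ring_nf, this,
      show π / (1 / (4 * s)) = 4 * π * s by field_simp, ← rpow_add (by positivity),
      neg_add_cancel, rpow_zero]
  -- A non-integrable function has Bochner integral $0$ by convention, so the value $1$ already
  -- gives integrability.
  exact ⟨not_imp_comm.1 integral_undef (h ▸ one_ne_zero), h⟩

/-- Up to a constant this is the Fourier transform of `ψ`, again Schwartz, evaluated at $r/(2\pi)$.
-/
theorem integrable_angularFourier {d : ℕ} (ψ : SchwartzMap (EuclideanSpace ℝ (Fin d)) ℂ) :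
    Integrable (angularFourier d ψ) := by
  have h := (SchwartzMap.integrable (μ := volume) (FourierTransform.fourier ψ)).comp_smul
    (R := (2 * π)⁻¹) (by positivity)
  refine (h.const_mul (1 / (2 * (π : ℂ)) ^ d)).congr (ae_of_all _ fun r => ?_)
  simp only [angularFourier]
  rw [SchwartzMap.fourier_coe, Real.fourier_eq']
  congr 2
  ext z
  rw [smul_eq_mul, inner_smul_right]
  congr 2
  push_cast
  have : (π : ℂ) ≠ 0 := by exact_mod_cast pi_ne_zero
  field_simp

/-- The case of a single Gaussian: Fubini moves the Fourier transform from `ψ` to the Gaussian,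
where it is explicit. -/
theorem integral_heatKernel_mul_schwartz {d : ℕ} {s : ℝ} (hs : 0 < s)
    (ψ : SchwartzMap (EuclideanSpace ℝ (Fin d)) ℂ) :
    ∫ z : EuclideanSpace ℝ (Fin d), (heatKernel d s ‖z‖ : ℂ) * ψ z =
      ∫ r : EuclideanSpace ℝ (Fin d), (exp (-(s * ‖r‖ ^ 2)) : ℂ) * angularFourier d ψ r := by
  have hsc : 0 < (s : ℂ).re := by simpa
  have hgi : Integrable fun r : EuclideanSpace ℝ (Fin d) => Complex.exp (-(s : ℂ) * ‖r‖ ^ 2) := by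
    simpa using GaussianFourier.integrable_cexp_neg_mul_sq_norm_add hsc 0
      (0 : EuclideanSpace ℝ (Fin d))
  have hint : Integrable (Function.uncurry fun r z : EuclideanSpace ℝ (Fin d) =>
      Complex.exp (-(s : ℂ) * ‖r‖ ^ 2) *
        (Complex.exp (-(Complex.I * (inner ℝ z r : ℝ))) * ψ z)) (volume.prod volume) := by
    have := hgi.mul_prod (SchwartzMap.integrable (μ := volume) ψ)
    refine this.mono ?_ (ae_of_all _ fun q => ?_)
    · refine Continuous.aestronglyMeasurable ?_
      have := ψ.continuous
      unfold Function.uncurry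
      fun_prop
    · simp only [Function.uncurry, norm_mul]
      rw [show -(Complex.I * ((inner ℝ q.2 q.1 : ℝ) : ℂ)) =
        ((-(inner ℝ q.2 q.1) : ℝ) : ℂ) * Complex.I by push_cast; ring,
        Complex.norm_exp_ofReal_mul_I, one_mul]
  have hswap := integral_integral_swap hint
  have hR : ∫ r : EuclideanSpace ℝ (Fin d), (exp (-(s * ‖r‖ ^ 2)) : ℂ) * angularFourier d ψ r =
      (1 / (2 * (π : ℂ)) ^ d) * ∫ r, ∫ z : EuclideanSpace ℝ (Fin d),
      Complex.exp (-(s : ℂ) * ‖r‖ ^ 2) *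
        (Complex.exp (-(Complex.I * (inner ℝ z r : ℝ))) * ψ z) := by
    rw [← integral_const_mul]
    congr 1
    ext r
    rw [integral_const_mul, angularFourier]
    push_cast
    ring_nf
  rw [hR, hswap, ← integral_const_mul]
  congr 1
  ext z
  have hin : ∫ r : EuclideanSpace ℝ (Fin d), Complex.exp (-(s : ℂ) * ‖r‖ ^ 2) *
        (Complex.exp (-(Complex.I * (inner ℝ z r : ℝ))) * ψ z) =
      ((π : ℂ) / s) ^ ((d : ℂ) / 2) *
        Complex.exp ((-Complex.I) ^ 2 * ‖z‖ ^ 2 / (4 * s)) * ψ z := by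
    have := GaussianFourier.integral_cexp_neg_mul_sq_norm_add hsc (-Complex.I) z
    rw [finrank_euclideanSpace, Fintype.card_fin] at this
    rw [← this, ← integral_mul_const]
    congr 1
    ext r
    rw [Complex.exp_add]
    ring_nf
  rw [hin, ← mul_assoc]
  congr 1
  have e1 : ((π : ℂ) / s) ^ ((d : ℂ) / 2) = (((π / s) ^ ((d : ℝ) / 2) : ℝ) : ℂ) := by
    rw [Complex.ofReal_cpow (by positivity)]
    push_cast; rfl
  have e2 : Complex.exp ((-Complex.I) ^ 2 * ‖z‖ ^ 2 / (4 * s)) =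
      ((exp (-(‖z‖ ^ 2 / (4 * s))) : ℝ) : ℂ) := by
    push_cast
    congr 1
    rw [neg_sq, Complex.I_sq]; ring
  rw [e1, e2, heatKernel]
  norm_cast
  rw [← mul_assoc]
  congr 1
  have e3 : ((2 * π) ^ d : ℝ) = (4 * π ^ 2) ^ ((d : ℝ) / 2) := by
    rw [show 4 * π ^ 2 = (2 * π) ^ (2 : ℝ) by norm_cast; ring, ← rpow_mul (by positivity),
      mul_div_cancel₀ _ (two_ne_zero), rpow_natCast]
  rw [e3, rpow_neg (by positivity), one_div, ← inv_rpow (by positivity),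
    ← inv_rpow (by positivity), ← mul_rpow (by positivity) (by positivity)]
  congr 1
  field_simp

/-! ### Spectral densities of Gaussian mixtures. -/

section Mixture

variable {κ : Measure ℝ} [IsFiniteMeasure κ]

/-- Each kernel is nonnegative of mass $1$ on $\mathbb{R}^d$, so the iterated integral is the mass
of $\kappa$. -/
theorem integrable_uncurry_heatKernel_norm (hκ : ∀ᵐ s ∂κ, 0 < s) (d : ℕ) :
    Integrable (Function.uncurry fun (s : ℝ) (z : EuclideanSpace ℝ (Fin d)) =>
      heatKernel d s ‖z‖) (κ.prod volume) := by
  rw [integrable_prod_iff]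
  · refine ⟨hκ.mono fun s hs => (integral_heatKernel_norm d hs).1,
      (integrable_const (1 : ℝ)).congr (hκ.mono fun s hs => ?_)⟩
    simp only [Function.uncurry]
    rw [← (integral_heatKernel_norm d hs).2]
    congr 1
    ext z
    exact (Real.norm_of_nonneg (heatKernel_nonneg d hs.le _)).symm
  · exact ((measurable_heatKernel d).comp (f := fun q : ℝ × EuclideanSpace ℝ (Fin d) =>
      (q.1, ‖q.2‖)) (by fun_prop)).aestronglyMeasurable

/-- The Gaussian-summed Hankel transform of a mixture of Gaussians. -/
theorem integral_gaussian_mul_hankelIntegrand_mixture (hκ : ∀ᵐ s ∂κ, 0 < s) {d : ℕ} (hd : 1 < d)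
    {φ : ℝ → ℝ} (hφ : ∀ r, 0 < r → φ r = ∫ s, exp (-(s * r ^ 2)) ∂κ) {z ε : ℝ} (hz : 0 < z)
    (hε : 0 < ε) :
    IntegrableOn (fun u => exp (-(ε * u ^ 2)) * hankelIntegrand d φ z u) (Ioi 0) ∧
    ∫ u in Ioi (0 : ℝ), exp (-(ε * u ^ 2)) * hankelIntegrand d φ z u =
      ∫ s, heatKernel d (s + ε) z ∂κ := by
  set W := hankelIntegrand d (fun _ => 1) z with hW
  have hWi := integrableOn_hankelIntegrand_gaussian hd hz hε
  have hint : Integrable (Function.uncurry fun u s : ℝ =>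
      exp (-(ε * u ^ 2)) * W u * exp (-(s * u ^ 2))) ((volume.restrict (Ioi 0)).prod κ) := by
    have := hWi.1.mul_prod (integrable_const (μ := κ) (1 : ℝ))
    refine this.mono ?_ ?_
    · refine (hWi.1.1.comp_fst (ν := κ)).mul
        (Continuous.aestronglyMeasurable (f := fun q : ℝ × ℝ => exp (-(q.2 * q.1 ^ 2)))
          (by fun_prop))
    · filter_upwards [Measure.quasiMeasurePreserving_snd.ae hκ] with q hq
      simp only [Function.uncurry]
      rw [norm_mul _ (exp _), norm_mul _ (1 : ℝ), norm_one]
      refine mul_le_mul_of_nonneg_left ?_ (norm_nonneg _)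
      rw [Real.norm_of_nonneg (exp_pos _).le, exp_le_one_iff]
      have : 0 ≤ q.2 * q.1 ^ 2 := by positivity
      linarith
  have hEq : ∀ u ∈ Ioi (0 : ℝ), exp (-(ε * u ^ 2)) * hankelIntegrand d φ z u =
      ∫ s, exp (-(ε * u ^ 2)) * W u * exp (-(s * u ^ 2)) ∂κ := fun u hu => by
    rw [integral_const_mul, ← hφ u hu, hW, hankelIntegrand, hankelIntegrand]
    ring
  refine ⟨IntegrableOn.congr_fun hint.integral_prod_left (fun u hu => (hEq u hu).symm)
    measurableSet_Ioi, ?_⟩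
  rw [setIntegral_congr_fun measurableSet_Ioi hEq, integral_integral_swap hint]
  refine integral_congr_ae (hκ.mono fun s hs => ?_)
  simp only
  rw [← (integrableOn_hankelIntegrand_gaussian hd hz (add_pos hs hε)).2]
  congr 1
  ext u
  rw [mul_right_comm, ← exp_add]
  ring_nf
  rfl

theorem tendsto_integral_heatKernel_add (hκ : ∀ᵐ s ∂κ, 0 < s) {d : ℕ} (hd : 0 < d) {z : ℝ}
    (hz : 0 < z) :
    Tendsto (fun ε : ℝ => ∫ s, heatKernel d (s + ε) z ∂κ) (𝓝[>] 0)
      (𝓝 (∫ s, heatKernel d s z ∂κ)) := by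
  refine tendsto_integral_filter_of_dominated_convergence
    (fun _ => ((d : ℝ) / 2 / (π * z ^ 2)) ^ ((d : ℝ) / 2)) ?_ ?_ (integrable_const _) ?_
  · exact Eventually.of_forall fun ε => ((measurable_heatKernel d).comp
      (f := fun s : ℝ => (s + ε, z)) (by fun_prop)).aestronglyMeasurable
  · refine eventually_mem_nhdsWithin.mono fun ε hε => hκ.mono fun s hs => ?_
    have : 0 < s + ε := add_pos hs hε
    rw [Real.norm_of_nonneg (heatKernel_nonneg d this.le z)]
    exact heatKernel_le hd this hz
  · refine hκ.mono fun s hs => ?_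
    have hc : ContinuousAt (fun ε : ℝ => heatKernel d (s + ε) z) 0 := by
      unfold heatKernel
      refine ContinuousAt.mul (ContinuousAt.rpow_const (by fun_prop) (Or.inl ?_))
        (ContinuousAt.rexp (ContinuousAt.neg (ContinuousAt.div (by fun_prop) (by fun_prop) ?_)))
      · rw [add_zero]; positivity
      · rw [add_zero]; positivity
    have := hc.tendsto.mono_left (nhdsWithin_le_nhds (s := Ioi (0 : ℝ)))
    rwa [add_zero] at this

/-- The isotropic spectral density of a mixture of Gaussians is the mixture of their spectral
densities. -/
theorem isIsotropicSpectralDensity_of_mixture (hκ : ∀ᵐ s ∂κ, 0 < s) {d : ℕ} (hd : 1 < d)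
    {φ f : ℝ → ℝ} (hφ : ∀ r, 0 < r → φ r = ∫ s, exp (-(s * r ^ 2)) ∂κ)
    (hf : ∀ z, 0 < z → f z = ∫ s, heatKernel d s z ∂κ) :
    IsIsotropicSpectralDensity d φ f := by
  have : Nontrivial (EuclideanSpace ℝ (Fin d)) := by
    have : Nonempty (Fin d) := ⟨⟨0, by omega⟩⟩
    infer_instance
  -- The origin is a null set in positive dimension, so the hypotheses on `φ` and `f`, which concern
  -- positive arguments only, suffice.
  have hne : ∀ᵐ z : EuclideanSpace ℝ (Fin d), 0 < ‖z‖ := by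
    filter_upwards [compl_mem_ae_iff.2 (measure_singleton (0 : EuclideanSpace ℝ (Fin d)))]
      with z hz using norm_pos_iff.2 hz
  have hHK := integrable_uncurry_heatKernel_norm hκ d
  have hsummed : ∀ z : ℝ, 0 < z →
      Tendsto (fun ε : ℝ => ∫ u in Ioi (0 : ℝ), exp (-(ε * u ^ 2)) * hankelIntegrand d φ z u)
      (𝓝[>] 0) (𝓝 (f z)) := fun z hz => by
    rw [hf z hz]
    refine (tendsto_integral_heatKernel_add hκ (by omega) hz).congr'
      (eventually_mem_nhdsWithin.mono fun ε hε => ?_)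
    exact (integral_gaussian_mul_hankelIntegrand_mixture hκ hd hφ hz hε).2.symm
  refine ⟨?_, fun ψ => ?_, hsummed, fun z hz l hl => ?_⟩
  · exact hHK.integral_prod_right.congr (hne.mono fun z hz => (hf _ hz).symm)
  · obtain ⟨C, hC⟩ : ∃ C, ∀ z, ‖ψ z‖ ≤ C := ⟨_, ψ.norm_le_seminorm ℝ⟩
    have hL : Integrable (Function.uncurry fun (s : ℝ) (z : EuclideanSpace ℝ (Fin d)) =>
        (heatKernel d s ‖z‖ : ℂ) * ψ z) (κ.prod volume) := by
      refine hHK.ofReal.mul_bdd (c := C) ?_ (ae_of_all _ fun q => hC q.2)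
      exact (ψ.continuous.comp continuous_snd).aestronglyMeasurable
    have hR : Integrable (Function.uncurry fun (s : ℝ) (r : EuclideanSpace ℝ (Fin d)) =>
        (exp (-(s * ‖r‖ ^ 2)) : ℂ) * angularFourier d ψ r) (κ.prod volume) := by
      have hA := integrable_angularFourier ψ
      refine ((integrable_const (1 : ℂ)).mul_prod hA).mono ?_ ?_
      · exact (Continuous.aestronglyMeasurable
          (f := fun q : ℝ × EuclideanSpace ℝ (Fin d) => ((exp (-(q.1 * ‖q.2‖ ^ 2)) : ℝ) : ℂ))
          (by fun_prop)).mul hA.1.comp_snd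
      · filter_upwards [Measure.quasiMeasurePreserving_fst.ae hκ] with q hq
        simp only [Function.uncurry]
        rw [norm_mul, norm_mul, norm_one]
        refine mul_le_mul_of_nonneg_right ?_ (norm_nonneg _)
        rw [Complex.norm_real, Real.norm_of_nonneg (exp_pos _).le, exp_le_one_iff]
        have : 0 ≤ q.1 * ‖q.2‖ ^ 2 := by positivity
        linarith
    calc ∫ z, (f ‖z‖ : ℂ) * ψ z = ∫ z, ∫ s, (heatKernel d s ‖z‖ : ℂ) * ψ z ∂κ := by
          refine integral_congr_ae (hne.mono fun z hz => ?_)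
          simp only
          rw [integral_mul_const, hf _ hz, integral_complex_ofReal]
      _ = ∫ s, (∫ z : EuclideanSpace ℝ (Fin d), (heatKernel d s ‖z‖ : ℂ) * ψ z) ∂κ :=
          (integral_integral_swap hL).symm
      _ = ∫ s, (∫ r : EuclideanSpace ℝ (Fin d),
          (exp (-(s * ‖r‖ ^ 2)) : ℂ) * angularFourier d ψ r) ∂κ :=
          integral_congr_ae (hκ.mono fun s hs => integral_heatKernel_mul_schwartz hs ψ)
      _ = ∫ r, ∫ s, (exp (-(s * ‖r‖ ^ 2)) : ℂ) * angularFourier d ψ r ∂κ :=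
          integral_integral_swap hR
      _ = ∫ r, (φ ‖r‖ : ℂ) * angularFourier d ψ r := by
          refine integral_congr_ae (hne.mono fun r hr => ?_)
          simp only
          rw [integral_mul_const, hφ _ hr, integral_complex_ofReal]
  · exact tendsto_nhds_unique (hsummed z hz)
      (tendsto_integral_gaussian_mul_of_tendsto_intervalIntegral
        (fun ε hε => (integral_gaussian_mul_hankelIntegrand_mixture hκ hd hφ hz hε).1) hl)

end Mixture

/-! ### Analytic continuation of the Dagum function to a strip. -/

theorem one_add_cexp_neg_mem_slitPlane {w : ℂ} (hw : |w.im| < π) :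
    1 + Complex.exp (-w) ∈ Complex.slitPlane := by
  rw [Complex.mem_slitPlane_iff]
  by_cases h : w.im = 0
  · left
    simp only [Complex.add_re, Complex.one_re, Complex.exp_re, Complex.neg_re, Complex.neg_im, h,
      neg_zero, cos_zero, mul_one]
    positivity
  · right
    have := abs_lt.1 hw
    simp only [Complex.add_im, Complex.one_im, Complex.exp_im, Complex.neg_re, Complex.neg_im,
      zero_add, sin_neg]
    refine mul_ne_zero (exp_pos _).ne' (neg_ne_zero.2 fun h0 => h ?_)
    exact (sin_eq_zero_iff_of_lt_of_lt this.1 this.2).1 h0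

/-- With $\rho=e^{-\mathrm{Re}\,w}$ and $-1<c\le\min(\cos(\mathrm{Im}\,w),0)$, $|1+e^{-w}|^2\ge
1+2c\rho+\rho^2=(1+c)+(1+c)\rho^2-c(1-\rho)^2\ge 1+c$. -/
theorem exists_le_norm_one_add_cexp_neg {θ : ℝ} (hθ : 0 ≤ θ) (hθπ : θ < π) :
    ∃ c : ℝ, 0 < c ∧ ∀ w : ℂ, |w.im| ≤ θ → c ≤ ‖1 + Complex.exp (-w)‖ := by
  set c := min (cos θ) 0
  have hc : -1 < c := by
    refine lt_min ?_ (by norm_num)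
    rw [← cos_pi]
    exact cos_lt_cos_of_nonneg_of_le_pi hθ le_rfl hθπ
  refine ⟨√(1 + c), sqrt_pos.2 (by linarith), fun w hw => ?_⟩
  refine sqrt_le_iff.2 ⟨norm_nonneg _, ?_⟩
  have hcos : c ≤ cos w.im := by
    rw [← cos_abs w.im]
    exact (min_le_left _ _).trans (cos_le_cos_of_nonneg_of_le_pi (abs_nonneg _) hθπ.le hw)
  have hρ : 0 < exp (-w.re) := exp_pos _
  rw [← Complex.normSq_eq_norm_sq, Complex.normSq_apply]
  simp only [Complex.add_im, Complex.one_im, Complex.exp_im, Complex.neg_re, Complex.neg_im,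
    zero_add, sin_neg, Complex.add_re, Complex.one_re, Complex.exp_re, cos_neg]
  have hc0 : c ≤ 0 := min_le_right _ _
  nlinarith [sin_sq_add_cos_sq w.im, mul_le_mul_of_nonneg_left hcos hρ.le,
    mul_nonneg (sub_nonneg.2 (le_of_lt hc)) (sq_nonneg (exp (-w.re))),
    mul_nonneg (neg_nonneg.2 hc0) (sq_nonneg (1 - exp (-w.re)))]

/-- A sum of vectors with arguments $0$ and $-\mathrm{Im}\,w$ stays in the sector between them. -/
theorem arg_one_add_cexp_neg_mem {w : ℂ} (h0 : 0 < w.im) (hπ : w.im < π) :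
    (1 + Complex.exp (-w)).arg ∈ Icc (-w.im) 0 := by
  set q := 1 + Complex.exp (-w) with hq
  have hre : q.re = 1 + exp (-w.re) * cos w.im := by
    simp [hq, Complex.exp_re]
  have him : q.im = -(exp (-w.re) * sin w.im) := by
    simp [hq, Complex.exp_im]
  have hsin : 0 < sin w.im := sin_pos_of_pos_of_lt_pi h0 hπ
  have hneg : q.im < 0 := by
    rw [him]; exact neg_neg_of_pos (by positivity)
  have harg : q.arg < 0 := Complex.arg_neg_iff.2 hneg
  have hq0 : q ≠ 0 := fun h => by rw [h] at hneg; simp at hneg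
  refine ⟨?_, harg.le⟩
  -- Rotating $q$ by $\mathrm{Im}\,w$ gives imaginary part $\sin(\mathrm{Im}\,w)>0$, which an
  -- argument below $-\mathrm{Im}\,w$ would make negative.
  by_contra! hlt
  have h1 : sin (w.im + q.arg) < 0 :=
    sin_neg_of_neg_of_neg_pi_lt (by linarith) (by linarith [Complex.neg_pi_lt_arg q])
  have h2 : ‖q‖ * sin (w.im + q.arg) = sin w.im := by
    rw [sin_add, mul_add, mul_left_comm, Complex.norm_mul_cos_arg, mul_left_comm,
      Complex.norm_mul_sin_arg, hre, him]
    ring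
  nlinarith [norm_pos_iff.2 hq0]

/-- The analytic continuation of the Dagum function in logarithmic coordinates:
`dagumExp lam δ x = dagum lam δ (exp x)` for real `x`. -/
noncomputable def dagumExp (lam δ : ℝ) (ζ : ℂ) : ℂ :=
  1 - (1 + Complex.exp (-(δ * ζ))) ^ (-(lam : ℂ))

/-- The negative of the imaginary part of the boundary value of the Dagum function on the positive
imaginary axis. -/
noncomputable def dagumBoundary (lam δ t : ℝ) : ℝ :=
  -(dagumExp lam δ (log t + (π / 2 : ℝ) * Complex.I)).im

theorem dagumExp_ofReal (lam δ x : ℝ) : dagumExp lam δ x = (dagum lam δ (exp x) : ℂ) := by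
  have h1 : (exp x) ^ δ / (1 + (exp x) ^ δ) = (1 + exp (-(δ * x)))⁻¹ := by
    rw [← exp_mul, exp_neg, mul_comm x δ]
    have := exp_pos (δ * x)
    field_simp
    ring
  rw [dagum, h1, inv_rpow (by positivity), ← rpow_neg (by positivity), dagumExp]
  push_cast
  rw [Complex.ofReal_cpow (by positivity)]
  push_cast
  rfl

section Strip

variable {lam δ : ℝ}

theorem abs_im_mul_lt {δ : ℝ} (hδ : δ ∈ Ioo (0 : ℝ) 2) {ζ : ℂ} (h : |ζ.im| ≤ π / 2) :
    |((δ : ℂ) * ζ).im| ≤ δ * (π / 2) ∧ δ * (π / 2) < π := by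
  rw [Complex.im_ofReal_mul, abs_mul, abs_of_pos hδ.1]
  exact ⟨by gcongr; exact hδ.1.le, by nlinarith [hδ.2, pi_pos]⟩

theorem differentiableAt_dagumExp {ζ : ℂ} (h : |((δ : ℂ) * ζ).im| < π) :
    DifferentiableAt ℂ (dagumExp lam δ) ζ := by
  unfold dagumExp
  refine (differentiableAt_const _).sub (DifferentiableAt.cpow_const (by fun_prop) ?_)
  exact one_add_cexp_neg_mem_slitPlane h

theorem differentiableAt_dagumExp_of_abs_im_le (hδ : δ ∈ Ioo (0 : ℝ) 2) {ζ : ℂ}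
    (h : |ζ.im| ≤ π / 2) : DifferentiableAt ℂ (dagumExp lam δ) ζ :=
  differentiableAt_dagumExp ((abs_im_mul_lt hδ h).1.trans_lt (abs_im_mul_lt hδ h).2)

/-- The base stays away from $0$ on the closed strip, and a real exponent makes the modulus of the
power depend only on that of the base. -/
theorem exists_norm_dagumExp_le (hδ : δ ∈ Ioo (0 : ℝ) 2) (hlam : 0 < lam) :
    ∃ C : ℝ, ∀ ζ : ℂ, |ζ.im| ≤ π / 2 → ‖dagumExp lam δ ζ‖ ≤ C := by
  obtain ⟨c, hc, hb⟩ := exists_le_norm_one_add_cexp_neg (θ := δ * (π / 2))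
    (by have := hδ.1; positivity) (by nlinarith [hδ.2, pi_pos])
  refine ⟨1 + c ^ (-lam), fun ζ hζ => ?_⟩
  have h1 := hb _ (abs_im_mul_lt hδ hζ).1
  have h0 : 1 + Complex.exp (-(δ * ζ)) ≠ 0 := norm_pos_iff.1 (hc.trans_le h1)
  unfold dagumExp
  refine (norm_sub_le _ _).trans ?_
  rw [norm_one, Complex.norm_cpow_of_ne_zero h0]
  simp only [Complex.neg_re, Complex.ofReal_re, Complex.neg_im, Complex.ofReal_im, neg_zero,
    mul_zero, exp_zero, div_one]
  gcongr 1 + ?_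
  exact rpow_le_rpow_of_nonpos hc h1 (by linarith)

/-- On this line the base has argument in $[-\delta\pi/2,0]$, so its power $-\lambda$ has argument
in $[0,\delta\lambda\pi/2]\subseteq[0,\pi]$. This is where $\delta\lambda\le 2$ enters, and the
source of the positivity of the mixture. -/
theorem im_dagumExp_nonpos (hδ : δ ∈ Ioo (0 : ℝ) 2) (hlam : δ * lam ∈ Ioc (0 : ℝ) 2) {ζ : ℂ}
    (h : ζ.im = π / 2) : (dagumExp lam δ ζ).im ≤ 0 := by
  have hlam0 : 0 < lam := pos_of_mul_pos_right hlam.1 hδ.1.le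
  have him : ((δ : ℂ) * ζ).im = δ * (π / 2) := by rw [Complex.im_ofReal_mul, h]
  have hlt := (abs_im_mul_lt hδ (ζ := ζ) (by rw [h, abs_of_pos (by positivity)]))
  have harg := arg_one_add_cexp_neg_mem (w := δ * ζ)
    (by rw [him]; have := hδ.1; positivity) (by rw [him]; exact hlt.2)
  rw [him] at harg
  have h0 := Complex.slitPlane_ne_zero
    (one_add_cexp_neg_mem_slitPlane (hlt.1.trans_lt hlt.2))
  set q := 1 + Complex.exp (-(δ * ζ)) with hq
  have hF : (dagumExp lam δ ζ).im = -(exp (log ‖q‖ * -lam) * sin (q.arg * -lam)) := by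
    rw [dagumExp, ← hq, Complex.cpow_def_of_ne_zero h0, Complex.sub_im, Complex.one_im,
      Complex.exp_im, zero_sub]
    congr 2
    · congr 1
      simp [Complex.mul_re, Complex.log_re]
    · simp [Complex.mul_im, Complex.log_im]
  rw [hF, neg_nonpos]
  refine mul_nonneg (exp_pos _).le (sin_nonneg_of_nonneg_of_le_pi ?_ ?_)
  · nlinarith [harg.2]
  · have h1 := harg.1
    have h2 := hlam.2
    have h3 : q.arg * -lam ≤ δ * (π / 2) * lam := by nlinarith
    nlinarith [pi_pos]

theorem dagumBoundary_nonneg (hδ : δ ∈ Ioo (0 : ℝ) 2) (hlam : δ * lam ∈ Ioc (0 : ℝ) 2) (t : ℝ) :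
    0 ≤ dagumBoundary lam δ t :=
  neg_nonneg.2 (im_dagumExp_nonpos hδ hlam (by simp))

theorem continuous_dagumExp_line (hδ : δ ∈ Ioo (0 : ℝ) 2) {y : ℝ} (hy : |y| ≤ π / 2) :
    Continuous fun x : ℝ => dagumExp lam δ (x + y * Complex.I) := by
  refine continuous_iff_continuousAt.2 fun x => ?_
  have := (differentiableAt_dagumExp_of_abs_im_le (lam := lam) hδ (ζ := x + y * Complex.I)
    (by simpa using hy)).continuousAt
  exact ContinuousAt.comp (f := fun x : ℝ => (x : ℂ) + y * Complex.I) this (by fun_prop)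

theorem measurable_dagumBoundary (hδ : δ ∈ Ioo (0 : ℝ) 2) :
    Measurable (dagumBoundary lam δ) := by
  have h := continuous_dagumExp_line (lam := lam) hδ (y := π / 2) (by rw [abs_of_pos (by positivity)])
  exact (Complex.measurable_im.comp (h.measurable.comp measurable_log)).neg

theorem tendsto_dagumExp_atTop (hδ : 0 < δ) (y : ℝ) :
    Tendsto (fun L : ℝ => dagumExp lam δ (L + y * Complex.I)) atTop (𝓝 0) := by
  have h1 : Tendsto (fun L : ℝ => Complex.exp (-(δ * (L + y * Complex.I)))) atTop (𝓝 0) := by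
    rw [tendsto_zero_iff_norm_tendsto_zero]
    simp only [Complex.norm_exp]
    refine tendsto_exp_atBot.comp ?_
    simp only [Complex.neg_re, Complex.re_ofReal_mul, Complex.add_re, Complex.ofReal_re,
      Complex.re_ofReal_mul, Complex.I_re, mul_zero, add_zero]
    exact tendsto_neg_atTop_atBot.comp (tendsto_id.const_mul_atTop hδ)
  have hc : ContinuousAt (fun w : ℂ => 1 - (1 + w) ^ (-(lam : ℂ))) 0 := by
    refine continuousAt_const.sub (ContinuousAt.cpow (by fun_prop) continuousAt_const ?_)
    simp
  have := hc.tendsto.comp h1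
  simpa [Function.comp_def, dagumExp] using this

end Strip

/-! ### The Stieltjes-type representation by Cauchy's theorem. -/

section Contour

variable {lam δ : ℝ}

/-- The kernel `(F ζ - F a) / (exp (2 ζ) - exp (2 a)) * exp (2 ζ)`, with `F = dagumExp lam δ` and
the removable singularity at `a` removed. -/
noncomputable def dagumKernel (lam δ a : ℝ) (ζ : ℂ) : ℂ :=
  dslope (dagumExp lam δ) a ζ / dslope (fun ζ => Complex.exp (2 * ζ)) (a : ℂ) ζ *
    Complex.exp (2 * ζ)

theorem dagumKernel_of_ne {a : ℝ} {ζ : ℂ} (h : ζ ≠ a) :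
    dagumKernel lam δ a ζ = (dagumExp lam δ ζ - dagumExp lam δ a) /
      (Complex.exp (2 * ζ) - Complex.exp (2 * a)) * Complex.exp (2 * ζ) := by
  rw [dagumKernel, dslope_of_ne _ h, dslope_of_ne _ h, slope_def_field, slope_def_field,
    div_div_div_cancel_right₀ (sub_ne_zero.2 h)]

/-- This form shows both ends of the strip: the last factor tends to $0$ on the left and to $1$ on
the right. -/
theorem dagumKernel_eq_inv {a : ℝ} {ζ : ℂ} (h : ζ ≠ a) :
    dagumKernel lam δ a ζ = (dagumExp lam δ ζ - dagumExp lam δ a) *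
      (1 - Complex.exp (2 * a - 2 * ζ))⁻¹ := by
  have h1 : Complex.exp (2 * ζ) - Complex.exp (2 * a) =
      (1 - Complex.exp (2 * a - 2 * ζ)) * Complex.exp (2 * ζ) := by
    rw [sub_mul, ← Complex.exp_add]; ring_nf
  rw [dagumKernel_of_ne h, h1]
  have := Complex.exp_ne_zero (2 * ζ)
  rw [← div_div, div_mul_cancel₀ _ this, div_eq_mul_inv]

/-- $e^{2\zeta}$ has period $\pi i$, larger than the height of the strip, so it takes the value
$e^{2a}$ only at $a$, where its derivative does not vanish. -/
theorem dslope_cexp_ne_zero {a : ℝ} {ζ : ℂ} (h0 : 0 ≤ ζ.im) (h1 : ζ.im ≤ π / 2) :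
    dslope (fun ζ => Complex.exp (2 * ζ)) (a : ℂ) ζ ≠ 0 := by
  by_cases h : ζ = a
  · have hd : HasDerivAt (fun ζ => Complex.exp (2 * ζ)) (Complex.exp (2 * a) * (2 * 1)) (a : ℂ) :=
      ((hasDerivAt_id (a : ℂ)).const_mul 2).cexp
    rw [h, dslope_same, hd.deriv]
    simp [Complex.exp_ne_zero]
  · rw [dslope_of_ne _ h, slope_def_field]
    refine div_ne_zero (sub_ne_zero.2 fun he => h ?_) (sub_ne_zero.2 h)
    obtain ⟨n, hn⟩ := Complex.exp_eq_exp_iff_exists_int.1 he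
    have him := congrArg Complex.im hn
    simp at him
    have him' : ζ.im = n * π := by linarith
    have hn0 : n = 0 := by
      have : (-1 : ℝ) < n := by
        by_contra! hc
        nlinarith [pi_pos]
      have : (n : ℝ) < 1 := by
        by_contra! hc
        nlinarith [pi_pos]
      have h3 : (-1 : ℤ) < n := by exact_mod_cast ‹(-1 : ℝ) < n›
      have h4 : n < (1 : ℤ) := by exact_mod_cast this
      omega
    rw [hn0] at hn
    simpa using hn

theorem continuousAt_dagumKernel (hδ : δ ∈ Ioo (0 : ℝ) 2) {a : ℝ} {ζ : ℂ} (h0 : 0 ≤ ζ.im)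
    (h1 : ζ.im ≤ π / 2) : ContinuousAt (dagumKernel lam δ a) ζ := by
  have hE : Differentiable ℂ fun ζ : ℂ => Complex.exp (2 * ζ) := by fun_prop
  have hF := differentiableAt_dagumExp_of_abs_im_le (lam := lam) hδ
    (ζ := ζ) (by rwa [abs_of_nonneg h0])
  have hFa := differentiableAt_dagumExp_of_abs_im_le (lam := lam) hδ
    (ζ := (a : ℂ)) (by simp; positivity)
  unfold dagumKernel
  refine (ContinuousAt.div ?_ ?_ (dslope_cexp_ne_zero h0 h1)).mul hE.continuous.continuousAt
  · by_cases h : ζ = a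
    · rw [h]; exact continuousAt_dslope_same.2 hFa
    · exact (continuousAt_dslope_of_ne h).2 hF.continuousAt
  · by_cases h : ζ = a
    · rw [h]; exact continuousAt_dslope_same.2 (hE _)
    · exact (continuousAt_dslope_of_ne h).2 (hE _).continuousAt

theorem differentiableAt_dagumKernel (hδ : δ ∈ Ioo (0 : ℝ) 2) {a : ℝ} {ζ : ℂ} (h0 : 0 < ζ.im)
    (h1 : ζ.im < π / 2) : DifferentiableAt ℂ (dagumKernel lam δ a) ζ := by
  have hE : Differentiable ℂ fun ζ : ℂ => Complex.exp (2 * ζ) := by fun_prop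
  have hne : ζ ≠ a := fun h => by rw [h] at h0; simp at h0
  have hF := differentiableAt_dagumExp_of_abs_im_le (lam := lam) hδ
    (ζ := ζ) (by rw [abs_of_pos h0]; exact h1.le)
  unfold dagumKernel
  exact (((differentiableAt_dslope_of_ne hne).2 hF).div
    ((differentiableAt_dslope_of_ne hne).2 (hE _)) (dslope_cexp_ne_zero h0.le h1.le)).mul (hE _)

theorem dagumKernel_im_real {a x : ℝ} (h : x ≠ a) : (dagumKernel lam δ a x).im = 0 := by
  rw [dagumKernel_of_ne (by exact_mod_cast h), dagumExp_ofReal, dagumExp_ofReal]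
  norm_cast

/-- On the top edge $e^{2\zeta}=-e^{2x}$, which turns the difference in the denominator into the sum
$e^{2x}+e^{2a}$; the term $F(a)$ is real and drops out. -/
theorem dagumKernel_im_top (a x : ℝ) :
    (dagumKernel lam δ a (x + (π / 2 : ℝ) * Complex.I)).im =
      -(dagumBoundary lam δ (exp x) * (exp x ^ 2 / (exp x ^ 2 + exp a ^ 2))) := by
  have hne : (x : ℂ) + (π / 2 : ℝ) * Complex.I ≠ a := fun h => by
    have := congrArg Complex.im h
    simp [pi_ne_zero] at this
  have hE : Complex.exp (2 * (x + (π / 2 : ℝ) * Complex.I)) = ((-exp x ^ 2 : ℝ) : ℂ) := by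
    rw [show 2 * ((x : ℂ) + (π / 2 : ℝ) * Complex.I) = (x : ℂ) + x + π * Complex.I by
      push_cast; ring, Complex.exp_add, Complex.exp_pi_mul_I, Complex.exp_add]
    push_cast; ring
  have hEa : Complex.exp (2 * a) = ((exp a ^ 2 : ℝ) : ℂ) := by
    rw [two_mul, Complex.exp_add]; push_cast; ring
  have hpos : 0 < exp x ^ 2 + exp a ^ 2 := by positivity
  have hq : ∀ A B : ℂ, (A - B) / (((-exp x ^ 2 : ℝ) : ℂ) - ((exp a ^ 2 : ℝ) : ℂ)) *
      ((-exp x ^ 2 : ℝ) : ℂ) = (A - B) * ((exp x ^ 2 / (exp x ^ 2 + exp a ^ 2) : ℝ) : ℂ) := by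
    intro A B
    have h2 : (((-exp x ^ 2 : ℝ) : ℂ) - ((exp a ^ 2 : ℝ) : ℂ)) =
        -((exp x ^ 2 + exp a ^ 2 : ℝ) : ℂ) := by push_cast; ring
    have h3 : ((exp x ^ 2 + exp a ^ 2 : ℝ) : ℂ) ≠ 0 := by exact_mod_cast hpos.ne'
    rw [h2, Complex.ofReal_div, Complex.ofReal_neg]
    field_simp
  rw [dagumKernel_of_ne hne, hE, hEa, hq, Complex.im_mul_ofReal, Complex.sub_im, dagumExp_ofReal,
    Complex.ofReal_im, dagumBoundary, log_exp]
  ring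

/-- Cauchy's theorem on the rectangle `[-L, L] × [0, π/2]`. -/
theorem integral_dagumBoundary_eq (hδ : δ ∈ Ioo (0 : ℝ) 2) (a L : ℝ) :
    ∫ x in -L..L, dagumBoundary lam δ (exp x) * (exp x ^ 2 / (exp x ^ 2 + exp a ^ 2)) =
      (∫ y in (0 : ℝ)..π / 2, dagumKernel lam δ a ((-L : ℝ) + y * Complex.I)).re -
      (∫ y in (0 : ℝ)..π / 2, dagumKernel lam δ a (L + y * Complex.I)).re := by
  have hpi : (0 : ℝ) ≤ π / 2 := by positivity
  have h := Complex.integral_boundary_rect_eq_zero_of_continuousOn_of_differentiableOn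
    (dagumKernel lam δ a) ((-L : ℝ) : ℂ) ((L : ℂ) + (π / 2 : ℝ) * Complex.I) ?_ ?_
  · have h' := congrArg Complex.im h
    simp only [Complex.ofReal_re, Complex.ofReal_im, Complex.add_re, Complex.add_im,
      Complex.re_ofReal_mul, Complex.I_re, Complex.I_im, mul_zero, mul_one,
      add_zero, zero_add, Complex.sub_im, smul_eq_mul, Complex.mul_im, one_mul, zero_mul,
      Complex.zero_im, Complex.ofReal_zero] at h'
    -- The kernel is real on the bottom edge, apart from the null set $\{a\}$ where only its
    -- `dslope` value is used.
    have hbot : (∫ x in -L..L, dagumKernel lam δ a (x : ℂ)).im = 0 := by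
      have : ∫ x in -L..L, dagumKernel lam δ a (x : ℂ) =
          ∫ x in -L..L, (((dagumKernel lam δ a (x : ℂ)).re : ℝ) : ℂ) := by
        refine intervalIntegral.integral_congr_ae ?_
        filter_upwards [compl_mem_ae_iff.2 (measure_singleton a)] with x hx _
        refine Complex.ext (by simp) ?_
        rw [Complex.ofReal_im]
        exact dagumKernel_im_real hx
      rw [this, intervalIntegral.integral_ofReal, Complex.ofReal_im]
    have htop : (∫ x in -L..L, dagumKernel lam δ a (x + (π / 2 : ℝ) * Complex.I)).im =
        -∫ x in -L..L, dagumBoundary lam δ (exp x) * (exp x ^ 2 / (exp x ^ 2 + exp a ^ 2)) := by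
      have hc : Continuous fun x : ℝ => dagumKernel lam δ a (x + (π / 2 : ℝ) * Complex.I) := by
        refine continuous_iff_continuousAt.2 fun x => ?_
        exact ContinuousAt.comp (f := fun x : ℝ => (x : ℂ) + (π / 2 : ℝ) * Complex.I)
          (continuousAt_dagumKernel hδ (by simpa using hpi) (by simp)) (by fun_prop)
      have := Complex.imCLM.intervalIntegral_comp_comm (hc.intervalIntegrable (μ := volume) (-L) L)
      simp only [Complex.imCLM_apply] at this
      rw [← this, ← intervalIntegral.integral_neg]
      simp only [dagumKernel_im_top]
    rw [hbot, htop] at h'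
    linarith
  · intro ζ hζ
    simp only [Complex.mem_reProdIm, Complex.ofReal_im, Complex.add_im, Complex.im_ofReal_mul,
      Complex.I_im, mul_one, zero_add, uIcc_of_le hpi] at hζ
    exact (continuousAt_dagumKernel hδ hζ.2.1 hζ.2.2).continuousWithinAt
  · intro ζ hζ
    simp only [Complex.mem_reProdIm, Complex.ofReal_im, Complex.add_im, Complex.im_ofReal_mul,
      Complex.I_im, mul_one, zero_add, min_eq_left hpi, max_eq_right hpi] at hζ
    exact (differentiableAt_dagumKernel hδ hζ.2.1 hζ.2.2).differentiableWithinAt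

theorem norm_cexp_sub_line (a x y : ℝ) :
    ‖Complex.exp (2 * a - 2 * (x + y * Complex.I))‖ = exp (2 * a - 2 * x) := by
  rw [Complex.norm_exp]
  simp

theorem line_ne_of_re_ne {a x : ℝ} (y : ℝ) (h : x ≠ a) : (x : ℂ) + y * Complex.I ≠ a := fun h' => by
  have := congrArg Complex.re h'
  simp at this
  exact h this

theorem tendsto_integral_dagumKernel_left (hδ : δ ∈ Ioo (0 : ℝ) 2) (hlam : 0 < lam) (a : ℝ) :
    Tendsto (fun L : ℝ => ∫ y in (0 : ℝ)..π / 2, dagumKernel lam δ a ((-L : ℝ) + y * Complex.I))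
      atTop (𝓝 0) := by
  obtain ⟨C, hC⟩ := exists_norm_dagumExp_le hδ hlam
  have hCa := hC a (by simp; positivity)
  have hlim : Tendsto (fun L : ℝ => (C + C) * (exp (2 * a - 2 * (-L)) - 1)⁻¹ * |π / 2 - 0|) atTop
      (𝓝 ((C + C) * 0 * |π / 2 - 0|)) := by
    refine (Tendsto.const_mul _ (tendsto_inv_atTop_zero.comp ?_)).mul_const _
    refine tendsto_atTop_add_const_right _ _ (tendsto_exp_atTop.comp ?_)
    refine tendsto_atTop_add_const_left _ _ ?_
    simp only [mul_neg, neg_neg]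
    exact tendsto_id.const_mul_atTop two_pos
  rw [mul_zero, zero_mul] at hlim
  refine squeeze_zero_norm' ?_ hlim
  filter_upwards [eventually_gt_atTop (-a)] with L hL
  refine intervalIntegral.norm_integral_le_of_norm_le_const fun y hy => ?_
  rw [uIoc_of_le (by positivity)] at hy
  rw [dagumKernel_eq_inv (line_ne_of_re_ne y (by linarith : -L ≠ a)), norm_mul, norm_inv]
  have h1 := hC ((-L : ℝ) + y * Complex.I) (by
    simp only [Complex.add_im, Complex.ofReal_im, Complex.im_ofReal_mul, Complex.I_im, mul_one,
      zero_add, abs_of_pos hy.1]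
    exact hy.2)
  have h2 : exp (2 * a - 2 * (-L)) - 1 ≤
      ‖1 - Complex.exp (2 * a - 2 * ((-L : ℝ) + y * Complex.I))‖ := by
    rw [← norm_cexp_sub_line a (-L) y, norm_sub_rev]
    refine le_trans ?_ (norm_sub_norm_le _ _)
    rw [norm_one]
  have h3 : 0 < exp (2 * a - 2 * (-L)) - 1 := by
    rw [sub_pos, one_lt_exp_iff]; linarith
  have h4 := (norm_sub_le (dagumExp lam δ ((-L : ℝ) + y * Complex.I)) (dagumExp lam δ a)).trans
    (add_le_add h1 hCa)
  gcongr
  exact (norm_nonneg _).trans h4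

/-- On the far right $F\to 0$ and the other factor tends to $1$, so the kernel tends to $-F(a)$ on a
segment of length $\pi/2$. The value of $D$ comes out of this edge, not out of a residue. -/
theorem tendsto_integral_dagumKernel_right (hδ : δ ∈ Ioo (0 : ℝ) 2) (hlam : 0 < lam) (a : ℝ) :
    Tendsto (fun L : ℝ => ∫ y in (0 : ℝ)..π / 2, dagumKernel lam δ a (L + y * Complex.I))
      atTop (𝓝 (-(π / 2) * dagumExp lam δ a)) := by
  obtain ⟨C, hC⟩ := exists_norm_dagumExp_le hδ hlam
  have hCa := hC a (by simp; positivity)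
  have hpi : (0 : ℝ) ≤ π / 2 := by positivity
  have hval : (-(π / 2) * dagumExp lam δ a : ℂ) =
      ∫ _ in (0 : ℝ)..π / 2, (0 - dagumExp lam δ a) * (1 - 0)⁻¹ := by
    rw [intervalIntegral.integral_const, sub_zero, sub_zero, inv_one, mul_one, zero_sub,
      Complex.real_smul]
    push_cast
    ring
  rw [hval]
  refine intervalIntegral.tendsto_integral_filter_of_dominated_convergence
    (fun _ => (C + C) * 2) ?_ ?_ intervalIntegrable_const ?_
  · refine Eventually.of_forall fun L => ContinuousOn.aestronglyMeasurable ?_ measurableSet_uIoc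
    intro y hy
    rw [uIoc_of_le hpi] at hy
    refine ContinuousAt.continuousWithinAt ?_
    exact ContinuousAt.comp (f := fun y : ℝ => (L : ℂ) + y * Complex.I)
      (continuousAt_dagumKernel hδ (by simpa using hy.1.le) (by simpa using hy.2)) (by fun_prop)
  -- The margin $1$ gives $e^{2a-2L}\le e^{-1}\le 1/2$, so the inverse factor is at most $2$.
  · filter_upwards [eventually_gt_atTop (a + 1)] with L hL
    refine ae_of_all _ fun y hy => ?_
    rw [uIoc_of_le hpi] at hy
    rw [dagumKernel_eq_inv (line_ne_of_re_ne y (by linarith : L ≠ a)), norm_mul, norm_inv]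
    have h1 := hC (L + y * Complex.I) (by
      simp only [Complex.add_im, Complex.ofReal_im, Complex.im_ofReal_mul, Complex.I_im, mul_one,
        zero_add, abs_of_pos hy.1]
      exact hy.2)
    have h2 : 1 / 2 ≤ ‖1 - Complex.exp (2 * a - 2 * (L + y * Complex.I))‖ := by
      refine le_trans ?_ (norm_sub_norm_le _ _)
      rw [norm_one, norm_cexp_sub_line]
      have h5 : exp (2 * a - 2 * L) ≤ exp (-1) := exp_le_exp.2 (by linarith)
      have h6 : exp (-1) ≤ 1 / 2 := by
        rw [exp_neg, one_div]
        exact inv_anti₀ two_pos (by linarith [add_one_le_exp (1 : ℝ)])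
      linarith
    have h4 := (norm_sub_le (dagumExp lam δ (L + y * Complex.I)) (dagumExp lam δ a)).trans
      (add_le_add h1 hCa)
    have h7 : ‖1 - Complex.exp (2 * a - 2 * (L + y * Complex.I))‖⁻¹ ≤ 2 := by
      rw [← one_div, ← one_div_one_div (2 : ℝ)]
      exact one_div_le_one_div_of_le (by norm_num) h2
    gcongr
    exact (norm_nonneg _).trans h4
  · refine ae_of_all _ fun y _ => ?_
    have h1 : Tendsto (fun L : ℝ => Complex.exp (2 * a - 2 * (L + y * Complex.I))) atTop (𝓝 0) := by
      rw [tendsto_zero_iff_norm_tendsto_zero]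
      simp only [norm_cexp_sub_line]
      refine tendsto_exp_atBot.comp (tendsto_atBot_add_const_left _ _ ?_)
      exact tendsto_neg_atTop_atBot.comp (tendsto_id.const_mul_atTop two_pos)
    refine Tendsto.congr' ?_ (((tendsto_dagumExp_atTop (lam := lam) hδ.1 y).sub_const
      (dagumExp lam δ a)).mul ((h1.const_sub 1).inv₀ (by simp)))
    filter_upwards [eventually_gt_atTop a] with L hL
    exact (dagumKernel_eq_inv (line_ne_of_re_ne y hL.ne')).symm

/-- The Dagum function as a Stieltjes-type mixture of the functions `r ↦ 1 / (t² + r²)`. -/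
theorem dagum_eq_integral_dagumBoundary (hδ : δ ∈ Ioo (0 : ℝ) 2)
    (hlam : δ * lam ∈ Ioc (0 : ℝ) 2) {r : ℝ} (hr : 0 < r) :
    IntegrableOn (fun t => t * dagumBoundary lam δ t / (t ^ 2 + r ^ 2)) (Ioi 0) ∧
    ∫ t in Ioi (0 : ℝ), t * dagumBoundary lam δ t / (t ^ 2 + r ^ 2) = π / 2 * dagum lam δ r := by
  have hlam0 : 0 < lam := pos_of_mul_pos_right hlam.1 hδ.1.le
  set a := log r
  have ha : exp a = r := exp_log hr
  set k : ℝ → ℝ := fun x => dagumBoundary lam δ (exp x) * (exp x ^ 2 / (exp x ^ 2 + exp a ^ 2))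
  have hk0 : ∀ x, 0 ≤ k x := fun x =>
    mul_nonneg (dagumBoundary_nonneg hδ hlam _) (by positivity)
  have hkc : Continuous k := by
    have h1 := continuous_dagumExp_line (lam := lam) hδ (y := π / 2)
      (by rw [abs_of_pos (by positivity)])
    have h2 : Continuous fun x => dagumBoundary lam δ (exp x) := by
      simp only [dagumBoundary, log_exp]
      exact (Complex.continuous_im.comp h1).neg
    exact h2.mul (Continuous.div (by fun_prop) (by fun_prop) fun x => by positivity)
  have hlim : Tendsto (fun L : ℝ => ∫ x in -L..L, k x) atTop (𝓝 (π / 2 * dagum lam δ r)) := by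
    simp only [k, integral_dagumBoundary_eq hδ a]
    have h1 := (Complex.continuous_re.tendsto _).comp
      (tendsto_integral_dagumKernel_left hδ hlam0 a)
    have h2 := (Complex.continuous_re.tendsto _).comp
      (tendsto_integral_dagumKernel_right hδ hlam0 a)
    have h3 := h1.sub h2
    rw [dagumExp_ofReal, ha] at h3
    convert! h3 using 2
    have h4 : (-(π / 2) * (dagum lam δ r : ℂ)) = ((-(π / 2) * dagum lam δ r : ℝ) : ℂ) := by
      push_cast; ring
    rw [h4, Complex.ofReal_re, Complex.zero_re]
    ring
  have hneg : Tendsto (fun L : ℝ => -L) atTop atBot := tendsto_neg_atTop_atBot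
  -- Since `k` is nonnegative, convergence over symmetric intervals is already absolute convergence.
  have hki : Integrable k := by
    refine integrable_of_intervalIntegral_norm_tendsto (π / 2 * dagum lam δ r)
      (fun L => (hkc.integrableOn_Icc (a := -L) (b := L)).mono_set Ioc_subset_Icc_self) hneg
      tendsto_id ?_
    simp only [Real.norm_of_nonneg (hk0 _)]
    exact hlim
  have hkv : ∫ x, k x = π / 2 * dagum lam δ r :=
    tendsto_nhds_unique (intervalIntegral_tendsto_integral hki hneg tendsto_id) hlim
  have himg : exp '' univ = Ioi (0 : ℝ) := by rw [image_univ, range_exp]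
  have hker : (fun x => |exp x| • (exp x * dagumBoundary lam δ (exp x) / (exp x ^ 2 + r ^ 2))) =
      k := by
    ext x
    simp only [k, ha, abs_exp, smul_eq_mul]
    ring
  have hderiv : ∀ x ∈ (univ : Set ℝ), HasDerivWithinAt exp (exp x) univ x :=
    fun x _ => (hasDerivAt_exp x).hasDerivWithinAt
  have hI := integrableOn_image_iff_integrableOn_abs_deriv_smul MeasurableSet.univ hderiv
    exp_injective.injOn (fun t => t * dagumBoundary lam δ t / (t ^ 2 + r ^ 2))
  have hV := integral_image_eq_integral_abs_deriv_smul MeasurableSet.univ hderiv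
    exp_injective.injOn (fun t => t * dagumBoundary lam δ t / (t ^ 2 + r ^ 2))
  rw [himg] at hI hV
  rw [hI, hV, hker, integrableOn_univ, setIntegral_univ]
  exact ⟨hki, hkv⟩

end Contour

/-! ### $K_{d/2-1}$ as a Gaussian mixture, and its integrability. -/

section BesselK

variable {d : ℕ} {z t : ℝ}

theorem integrableOn_exp_mul_heatKernel (hd : 0 < d) (hz : 0 < z) (ht : 0 < t) :
    IntegrableOn (fun s => exp (-(s * t ^ 2)) * heatKernel d s z) (Ioi 0) := by
  have h1 : IntegrableOn (fun s => exp (-(t ^ 2) * s)) (Ioi 0) :=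
    exp_neg_integrableOn_Ioi 0 (by positivity)
  refine Integrable.mul_bdd (c := ((d : ℝ) / 2 / (π * z ^ 2)) ^ ((d : ℝ) / 2)) ?_ ?_ ?_
  · exact h1.congr_fun (fun s _ => by ring_nf) measurableSet_Ioi
  · exact ((measurable_heatKernel d).comp (f := fun s : ℝ => (s, z))
      (by fun_prop)).aestronglyMeasurable
  · refine (ae_restrict_iff' measurableSet_Ioi).2 (ae_of_all _ fun s hs => ?_)
    rw [Real.norm_of_nonneg (heatKernel_nonneg d (le_of_lt hs) z)]
    exact heatKernel_le hd hs hz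

/-- Averaging over $u\mapsto -u$ turns the exponential into $\cosh(\nu u)$ and folds the line onto
the half-line. -/
theorem integral_exp_cosh_sub {ν x : ℝ}
    (hi : Integrable fun u : ℝ => exp (-(x * cosh u)) * exp (-(ν * u))) :
    ∫ u : ℝ, exp (-(x * cosh u)) * exp (-(ν * u)) = 2 * besselK ν x := by
  set G : ℝ → ℝ := fun u => exp (-(x * cosh u)) * exp (-(ν * u))
  have h1 : ∫ u, G u = ∫ u, (G u + G (-u)) / 2 := by
    rw [integral_div, integral_add hi hi.comp_neg, integral_neg_eq_self]
    ring
  have h2 : (fun u => (G u + G (-u)) / 2) =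
      fun u => exp (-(x * cosh |u|)) * cosh (ν * |u|) := by
    ext u
    have : cosh (ν * |u|) = cosh (ν * u) := by
      rw [← cosh_abs (ν * |u|), ← cosh_abs (ν * u), abs_mul, abs_mul, abs_abs]
    rw [this, cosh_abs, cosh_eq (ν * u)]
    simp only [G, cosh_neg]
    ring_nf
  rw [h1, h2, integral_comp_abs (f := fun u => exp (-(x * cosh u)) * cosh (ν * u)), besselK]

/-- The Gaussian mixture representation of `K_{d/2-1}`. -/
theorem integral_exp_mul_heatKernel (hd : 0 < d) (hz : 0 < z) (ht : 0 < t) :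
    ∫ s in Ioi (0 : ℝ), exp (-(s * t ^ 2)) * heatKernel d s z =
      (2 * π) ^ (-((d : ℝ) / 2)) * (t / z) ^ ((d : ℝ) / 2 - 1) *
        besselK ((d : ℝ) / 2 - 1) (z * t) := by
  set ν := (d : ℝ) / 2 - 1 with hν
  -- At $s=b$ the exponents $st^2$ and $z^2/(4s)$ are equal, so with $s=be^u$ their sum is $zt\cosh
  -- u$.
  set b := z / (2 * t) with hb
  have hb0 : 0 < b := by positivity
  have himg : (fun u => b * exp u) '' univ = Ioi (0 : ℝ) := by
    ext s
    simp only [image_univ, mem_range, mem_Ioi]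
    constructor
    · rintro ⟨u, rfl⟩; positivity
    · intro hs
      exact ⟨log (s / b), by rw [exp_log (by positivity)]; field_simp⟩
  have hderiv : ∀ x ∈ (univ : Set ℝ),
      HasDerivWithinAt (fun u => b * exp u) (b * exp x) univ x :=
    fun x _ => ((hasDerivAt_exp x).const_mul b).hasDerivWithinAt
  have hinj : InjOn (fun u => b * exp u) univ := fun x _ y _ h =>
    exp_injective (mul_left_cancel₀ hb0.ne' h)
  set c := (2 * π) ^ (-((d : ℝ) / 2)) * (t / z) ^ ν / 2
  have hc0 : c ≠ 0 := by positivity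
  have hker : (fun u => |b * exp u| •
      (exp (-(b * exp u * t ^ 2)) * heatKernel d (b * exp u) z)) =
      fun u => c * (exp (-(z * t * cosh u)) * exp (-(ν * u))) := by
    ext u
    rw [smul_eq_mul, abs_of_pos (by positivity), heatKernel]
    have e1 : exp (-(b * exp u * t ^ 2)) * exp (-(z ^ 2 / (4 * (b * exp u)))) =
        exp (-(z * t * cosh u)) := by
      rw [← exp_add, cosh_eq, exp_neg u]
      congr 1
      rw [hb]
      field_simp
      ring
    have e2 : b * exp u * (4 * π * (b * exp u)) ^ (-((d : ℝ) / 2)) = c * exp (-(ν * u)) := by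
      have hs : 0 < b * exp u := by positivity
      have e3 : (4 * π * (b * exp u)) ^ (-((d : ℝ) / 2)) =
          (4 * π) ^ (-((d : ℝ) / 2)) * (b * exp u) ^ (-((d : ℝ) / 2)) :=
        mul_rpow (by positivity) hs.le
      have e4 : b * exp u * (b * exp u) ^ (-((d : ℝ) / 2)) = b ^ (-ν) * exp (-(ν * u)) := by
        nth_rw 1 [← rpow_one (b * exp u)]
        rw [← rpow_add hs, show (1 : ℝ) + -((d : ℝ) / 2) = -ν by rw [hν]; ring,
          mul_rpow hb0.le (exp_pos _).le, ← exp_mul]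
        ring_nf
      have e5 : (4 * π) ^ (-((d : ℝ) / 2)) * b ^ (-ν) = c := by
        have f1 : (4 * π) ^ (-((d : ℝ) / 2)) =
            2 ^ (-((d : ℝ) / 2)) * (2 * π) ^ (-((d : ℝ) / 2)) := by
          rw [← mul_rpow (by positivity) (by positivity)]; ring_nf
        have f2 : b ^ (-ν) = 2 ^ ν * (t / z) ^ ν := by
          rw [rpow_neg hb0.le, ← inv_rpow hb0.le, ← mul_rpow (by positivity) (by positivity)]
          congr 1
          rw [hb]; field_simp
        have f3 : (2 : ℝ) ^ (-((d : ℝ) / 2)) * 2 ^ ν = 1 / 2 := by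
          rw [← rpow_add two_pos, show -((d : ℝ) / 2) + ν = -1 by rw [hν]; ring, rpow_neg_one]
          norm_num
        rw [f1, f2]
        linear_combination (2 * π) ^ (-((d : ℝ) / 2)) * (t / z) ^ ν * f3
      rw [e3, mul_left_comm, e4, ← mul_assoc, e5]
    calc _ = (b * exp u * (4 * π * (b * exp u)) ^ (-((d : ℝ) / 2))) *
          (exp (-(b * exp u * t ^ 2)) * exp (-(z ^ 2 / (4 * (b * exp u))))) := by ring
      _ = _ := by rw [e1, e2]; ring
  have hI := integrableOn_image_iff_integrableOn_abs_deriv_smul MeasurableSet.univ hderiv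
    hinj (fun s => exp (-(s * t ^ 2)) * heatKernel d s z)
  have hV := integral_image_eq_integral_abs_deriv_smul MeasurableSet.univ hderiv
    hinj (fun s => exp (-(s * t ^ 2)) * heatKernel d s z)
  rw [himg, hker] at hI hV
  have hi := hI.1 (integrableOn_exp_mul_heatKernel hd hz ht)
  rw [integrableOn_univ, integrable_const_mul_iff (IsUnit.mk0 c hc0)] at hi
  rw [hV, setIntegral_univ, integral_const_mul, integral_exp_cosh_sub hi]
  simp only [c]
  ring

/-- Dividing by $s$ amounts to raising the dimension by two: `heatKernel_le` in dimension $d+2$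
controls $s\le 1$, and the decay $s^{-(d+2)/2}$ controls $s>1$. -/
theorem integrableOn_heatKernel_div (hd : 0 < d) (hz : 0 < z) :
    IntegrableOn (fun s => heatKernel d s z / s) (Ioi 0) := by
  have hEq : ∀ s ∈ Ioi (0 : ℝ), 4 * π * heatKernel (d + 2) s z = heatKernel d s z / s := by
    intro s hs
    have hs' : 0 < s := hs
    rw [heatKernel, heatKernel, show -(((d + 2 : ℕ) : ℝ) / 2) = -((d : ℝ) / 2) - 1 by
      push_cast; ring, rpow_sub_one (by positivity)]
    field_simp
  have hm : Measurable fun s => heatKernel (d + 2) s z :=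
    (measurable_heatKernel (d + 2)).comp (f := fun s : ℝ => (s, z)) (by fun_prop)
  refine IntegrableOn.congr_fun (Integrable.const_mul ?_ _) hEq measurableSet_Ioi
  rw [← Ioc_union_Ioi_eq_Ioi (zero_le_one' ℝ)]
  refine IntegrableOn.union ?_ ?_
  · refine Measure.integrableOn_of_bounded
      (M := (((d + 2 : ℕ) : ℝ) / 2 / (π * z ^ 2)) ^ (((d + 2 : ℕ) : ℝ) / 2))
      (by simp) hm.aestronglyMeasurable ?_
    refine (ae_restrict_iff' measurableSet_Ioc).2 (ae_of_all _ fun s hs => ?_)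
    rw [Real.norm_of_nonneg (heatKernel_nonneg _ hs.1.le z)]
    exact heatKernel_le (by omega) hs.1 hz
  · have hexp : -(((d + 2 : ℕ) : ℝ) / 2) < -1 := by
      have : (0 : ℝ) < d := by exact_mod_cast hd
      push_cast; linarith
    refine ((integrableOn_Ioi_rpow_of_lt hexp one_pos).const_mul
      ((4 * π) ^ (-(((d + 2 : ℕ) : ℝ) / 2)))).mono' hm.aestronglyMeasurable ?_
    refine (ae_restrict_iff' measurableSet_Ioi).2 (ae_of_all _ fun s hs => ?_)
    have hs' : (0 : ℝ) < s := one_pos.trans hs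
    rw [Real.norm_of_nonneg (heatKernel_nonneg _ hs'.le z), heatKernel,
      mul_rpow (by positivity) hs'.le]
    refine mul_le_of_le_one_right (by positivity) (exp_le_one_iff.2 ?_)
    rw [neg_nonpos]; positivity

theorem rpow_mul_besselK_eq (hd : 0 < d) (hz : 0 < z) (ht : 0 < t) :
    t ^ ((d : ℝ) / 2) * besselK ((d : ℝ) / 2 - 1) (z * t) =
      (2 * π) ^ ((d : ℝ) / 2) * z ^ ((d : ℝ) / 2 - 1) *
        ∫ s in Ioi (0 : ℝ), t * (exp (-(s * t ^ 2)) * heatKernel d s z) := by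
  rw [integral_const_mul, integral_exp_mul_heatKernel hd hz ht, rpow_neg (by positivity),
    div_rpow ht.le hz.le, rpow_sub_one ht.ne']
  have h1 : (2 * π) ^ ((d : ℝ) / 2) ≠ 0 := by positivity
  have h2 : z ^ ((d : ℝ) / 2 - 1) ≠ 0 := by positivity
  field_simp

/-- By Tonelli, no asymptotics of $K$ are needed: integrating $te^{-st^2}$ in $t$ first gives
$1/(2s)$, and the kernel divided by $s$ is integrable. -/
theorem integrableOn_rpow_mul_besselK (hd : 0 < d) (hz : 0 < z) :
    IntegrableOn (fun t => t ^ ((d : ℝ) / 2) * besselK ((d : ℝ) / 2 - 1) (z * t)) (Ioi 0) := by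
  have hm : Measurable fun q : ℝ × ℝ => q.1 * (exp (-(q.2 * q.1 ^ 2)) * heatKernel d q.2 z) := by
    have := (measurable_heatKernel d).comp (f := fun q : ℝ × ℝ => (q.2, z)) (by fun_prop)
    simp only [Function.comp_def] at this
    fun_prop
  have hmass : ∀ s ∈ Ioi (0 : ℝ), IntegrableOn (fun t => t * exp (-(s * t ^ 2))) (Ioi 0) ∧
      ∫ t in Ioi (0 : ℝ), t * exp (-(s * t ^ 2)) = (2 * s)⁻¹ := by
    intro s hs
    have hs' : 0 < s := hs
    obtain ⟨h1, h2⟩ := integral_Ioi_mul_exp_neg_mul_sq hs' (le_refl (0 : ℝ))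
    have hEq : (fun t => t * exp (-(s * t ^ 2))) =
        fun t => (2 * s)⁻¹ * (2 * s * t * exp (-(s * t ^ 2))) := by
      ext t; field_simp
    rw [hEq, integral_const_mul, h2]
    exact ⟨h1.const_mul _, by simp⟩
  have hint : Integrable (fun q : ℝ × ℝ => q.1 * (exp (-(q.2 * q.1 ^ 2)) * heatKernel d q.2 z))
      ((volume.restrict (Ioi 0)).prod (volume.restrict (Ioi 0))) := by
    rw [integrable_prod_iff' hm.aestronglyMeasurable]
    constructor
    · refine (ae_restrict_iff' measurableSet_Ioi).2 (ae_of_all _ fun s hs => ?_)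
      simp only [← mul_assoc]
      exact (hmass s hs).1.mul_const _
    · refine IntegrableOn.congr_fun ((integrableOn_heatKernel_div hd hz).const_mul (1 / 2))
        (fun s hs => ?_) measurableSet_Ioi
      have hs' : (0 : ℝ) < s := hs
      have hn : ∀ t ∈ Ioi (0 : ℝ), ‖t * (exp (-(s * t ^ 2)) * heatKernel d s z)‖ =
          t * exp (-(s * t ^ 2)) * heatKernel d s z := fun t ht => by
        have ht' : (0 : ℝ) < t := ht
        have := heatKernel_nonneg d hs'.le z
        rw [Real.norm_of_nonneg (by positivity), mul_assoc]
      simp only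
      rw [setIntegral_congr_fun measurableSet_Ioi hn, integral_mul_const, (hmass s hs).2]
      field_simp
  exact IntegrableOn.congr_fun (hint.integral_prod_left.const_mul _)
    (fun t ht => (rpow_mul_besselK_eq hd hz ht).symm) measurableSet_Ioi

end BesselK

/-! ### The rotated integrand as a boundary value. -/

section Rotated

variable {d : ℕ} {lam δ z t : ℝ}

/-- From $1+e^w=e^w(1+e^{-w})$. The principal logarithm is additive here because the two arguments
add up to a value in $[0,\mathrm{Im}\,w]$, inside $(-\pi,\pi]$. -/
theorem cexp_mul_div_one_add_cexp_cpow {w : ℂ} (h0 : 0 < w.im) (hπ : w.im < π) (lam : ℂ) :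
    Complex.exp (lam * w) / (1 + Complex.exp w) ^ lam = (1 + Complex.exp (-w)) ^ (-lam) := by
  have hq := Complex.slitPlane_ne_zero
    (one_add_cexp_neg_mem_slitPlane (w := w) (by rwa [abs_of_pos h0]))
  have harg := arg_one_add_cexp_neg_mem h0 hπ
  set q := 1 + Complex.exp (-w) with hqd
  have hfac : 1 + Complex.exp w = Complex.exp w * q := by
    rw [hqd, mul_add, ← Complex.exp_add, add_neg_cancel, Complex.exp_zero]; ring
  have hlogw : Complex.log (Complex.exp w) = w := Complex.log_exp (by linarith) hπ.le
  have hargw : (Complex.exp w).arg = w.im := by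
    rw [← Complex.log_im, hlogw]
  have hlog : Complex.log (Complex.exp w * q) = w + Complex.log q := by
    rw [(Complex.log_mul_eq_add_log_iff (Complex.exp_ne_zero _) hq).2, hlogw]
    rw [hargw]
    exact ⟨by linarith [harg.1], by linarith [harg.2]⟩
  rw [hfac, Complex.cpow_def_of_ne_zero (mul_ne_zero (Complex.exp_ne_zero _) hq), hlog,
    Complex.cpow_def_of_ne_zero hq, ← Complex.exp_sub]
  ring_nf

theorem rotatedIntegrand_eq (hδ : δ ∈ Ioo (0 : ℝ) 2) (ht : 0 < t) :
    rotatedIntegrand d lam δ z t =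
      ((t ^ ((d : ℝ) / 2) * besselK ((d : ℝ) / 2 - 1) (z * t) : ℝ) : ℂ) *
        dagumExp lam δ (log t + (π / 2 : ℝ) * Complex.I) := by
  set w : ℂ := δ * (log t + (π / 2 : ℝ) * Complex.I) with hw
  have him : w.im = δ * (π / 2) := by simp [hw]
  have hw0 : 0 < w.im := by rw [him]; have := hδ.1; positivity
  have hwπ : w.im < π := by rw [him]; nlinarith [hδ.2, pi_pos]
  have h1 : Complex.exp (Complex.I * π * δ / 2) * ((t ^ δ : ℝ) : ℂ) = Complex.exp w := by
    rw [rpow_def_of_pos ht, Complex.ofReal_exp, ← Complex.exp_add, hw]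
    congr 1
    push_cast; ring
  have h2 : ((t ^ (δ * lam) : ℝ) : ℂ) * Complex.exp (Complex.I * π * δ * lam / 2) =
      Complex.exp (lam * w) := by
    rw [rpow_def_of_pos ht, Complex.ofReal_exp, ← Complex.exp_add, hw]
    congr 1
    push_cast; ring
  rw [rotatedIntegrand, h1, h2, cexp_mul_div_one_add_cexp_cpow hw0 hwπ, dagumExp, ← hw]
  push_cast
  ring

theorem rotatedIntegrand_im (hδ : δ ∈ Ioo (0 : ℝ) 2) (ht : 0 < t) :
    (rotatedIntegrand d lam δ z t).im =
      -(t ^ ((d : ℝ) / 2) * besselK ((d : ℝ) / 2 - 1) (z * t) * dagumBoundary lam δ t) := by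
  rw [rotatedIntegrand_eq hδ ht, Complex.im_ofReal_mul, dagumBoundary]
  ring

theorem integrableOn_rotatedIntegrand (hd : 0 < d) (hδ : δ ∈ Ioo (0 : ℝ) 2) (hlam : 0 < lam)
    (hz : 0 < z) : IntegrableOn (rotatedIntegrand d lam δ z) (Ioi 0) := by
  obtain ⟨C, hC⟩ := exists_norm_dagumExp_le hδ hlam
  have hline := continuous_dagumExp_line (lam := lam) hδ (y := π / 2)
    (by rw [abs_of_pos (by positivity)])
  refine IntegrableOn.congr_fun (Integrable.mul_bdd (c := C)
    (integrableOn_rpow_mul_besselK hd hz).ofReal ?_ ?_)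
    (fun t ht => (rotatedIntegrand_eq hδ ht).symm) measurableSet_Ioi
  · exact (hline.measurable.comp measurable_log).aestronglyMeasurable
  · refine ae_of_all _ fun t => hC _ ?_
    simp [abs_of_pos (half_pos pi_pos)]

end Rotated

/-! ### The mixing measure and the final formula. -/

section DagumMixture

variable {lam δ : ℝ}

/-- The density, with respect to the scale `t`, of the mixture of the functions
`r ↦ 1 / (t² + r²)` that gives the Dagum function. -/
noncomputable def dagumWeight (lam δ t : ℝ) : ENNReal :=
  ENNReal.ofReal (2 / π * (t * dagumBoundary lam δ t))

/-- The measure on `(0, ∞)` whose Laplace transform at `r²` is the Dagum function at `r`. -/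
noncomputable def dagumMixture (lam δ : ℝ) : Measure ℝ :=
  (volume.restrict (Ioi 0)).withDensity fun s =>
    ∫⁻ t in Ioi (0 : ℝ), dagumWeight lam δ t * ENNReal.ofReal (exp (-(s * t ^ 2)))

theorem measurable_dagumWeight (hδ : δ ∈ Ioo (0 : ℝ) 2) : Measurable (dagumWeight lam δ) := by
  have := measurable_dagumBoundary (lam := lam) hδ
  unfold dagumWeight
  fun_prop

theorem ae_dagumMixture_pos (lam δ : ℝ) : ∀ᵐ s ∂dagumMixture lam δ, 0 < s :=
  (withDensity_absolutelyContinuous _ _).ae_le (ae_restrict_mem measurableSet_Ioi)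

/-- Tonelli in $[0,\infty]$, free of integrability conditions. It is applied both to $e^{-sr^2}$,
recovering $D$, and to the Gaussian density, producing $K$. -/
theorem lintegral_dagumMixture (hδ : δ ∈ Ioo (0 : ℝ) 2) {F : ℝ → ENNReal} (hF : Measurable F) :
    ∫⁻ s, F s ∂dagumMixture lam δ = ∫⁻ t in Ioi (0 : ℝ), dagumWeight lam δ t *
      ∫⁻ s in Ioi (0 : ℝ), ENNReal.ofReal (exp (-(s * t ^ 2))) * F s := by
  have hw := measurable_dagumWeight (lam := lam) hδ
  have hj : Measurable (Function.uncurry fun s t : ℝ =>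
      dagumWeight lam δ t * ENNReal.ofReal (exp (-(s * t ^ 2)))) := by
    unfold Function.uncurry; fun_prop
  have hj' : Measurable (Function.uncurry fun s t : ℝ =>
      dagumWeight lam δ t * ENNReal.ofReal (exp (-(s * t ^ 2))) * F s) := by
    unfold Function.uncurry; fun_prop
  have hm : Measurable fun s : ℝ =>
      ∫⁻ t in Ioi (0 : ℝ), dagumWeight lam δ t * ENNReal.ofReal (exp (-(s * t ^ 2))) :=
    hj.lintegral_prod_right'
  rw [dagumMixture, lintegral_withDensity_eq_lintegral_mul _ hm hF]
  simp only [Pi.mul_apply]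
  calc _ = ∫⁻ s in Ioi (0 : ℝ), ∫⁻ t in Ioi (0 : ℝ),
        dagumWeight lam δ t * ENNReal.ofReal (exp (-(s * t ^ 2))) * F s := by
        congr 1
        ext s
        exact (lintegral_mul_const _ (hj.comp (measurable_prodMk_left (x := s)))).symm
    _ = _ := by
        rw [lintegral_lintegral_swap hj'.aemeasurable]
        congr 1
        ext t
        simp only [mul_assoc]
        rw [lintegral_const_mul _ (by fun_prop)]

theorem lintegral_exp_dagumMixture (hδ : δ ∈ Ioo (0 : ℝ) 2) (hlam : δ * lam ∈ Ioc (0 : ℝ) 2)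
    {r : ℝ} (hr : 0 < r) :
    ∫⁻ s, ENNReal.ofReal (exp (-(s * r ^ 2))) ∂dagumMixture lam δ =
      ENNReal.ofReal (dagum lam δ r) := by
  obtain ⟨h1, h2⟩ := dagum_eq_integral_dagumBoundary hδ hlam hr
  have hg := dagumBoundary_nonneg hδ hlam
  have hD : dagum lam δ r =
      ∫ t in Ioi (0 : ℝ), 2 / π * (t * dagumBoundary lam δ t / (t ^ 2 + r ^ 2)) := by
    rw [integral_const_mul, h2]
    have := pi_ne_zero
    field_simp
  rw [hD, ofReal_integral_eq_lintegral_ofReal (h1.const_mul _)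
    ((ae_restrict_iff' measurableSet_Ioi).2 (ae_of_all _ fun t ht => by
      have ht' : (0 : ℝ) < t := ht
      have := hg t
      simp only [Pi.zero_apply]
      positivity)), lintegral_dagumMixture hδ (by fun_prop)]
  refine setLIntegral_congr_fun measurableSet_Ioi fun t ht => ?_
  have ht' : (0 : ℝ) < t := ht
  have hb : 0 < t ^ 2 + r ^ 2 := by positivity
  have hin : ∫⁻ s in Ioi (0 : ℝ), ENNReal.ofReal (exp (-(s * t ^ 2))) *
      ENNReal.ofReal (exp (-(s * r ^ 2))) = ENNReal.ofReal (1 / (t ^ 2 + r ^ 2)) := by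
    have hEq : ∀ s : ℝ, ENNReal.ofReal (exp (-(s * t ^ 2))) *
        ENNReal.ofReal (exp (-(s * r ^ 2))) =
        ENNReal.ofReal (exp (-(t ^ 2 + r ^ 2) * s)) := fun s => by
      rw [← ENNReal.ofReal_mul (exp_pos _).le, ← exp_add]
      ring_nf
    simp only [hEq]
    rw [← ofReal_integral_eq_lintegral_ofReal (exp_neg_integrableOn_Ioi 0 hb)
      (ae_of_all _ fun s => (exp_pos _).le), integral_exp_mul_Ioi (by linarith) 0]
    rw [mul_zero, exp_zero, neg_div_neg_eq]
  have := hg t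
  rw [hin, dagumWeight, ← ENNReal.ofReal_mul (by positivity)]
  congr 1
  ring

theorem dagum_le_one (lam δ : ℝ) {r : ℝ} (hr : 0 ≤ r) : dagum lam δ r ≤ 1 := by
  unfold dagum
  have : 0 ≤ (r ^ δ / (1 + r ^ δ)) ^ lam := by positivity
  linarith

/-- The Laplace transform at $r^2$ equals $D(r)\le 1$; Fatou's lemma along $r=1/(n+1)\to 0$ bounds
the total mass by $1$. -/
theorem isFiniteMeasure_dagumMixture (hδ : δ ∈ Ioo (0 : ℝ) 2)
    (hlam : δ * lam ∈ Ioc (0 : ℝ) 2) : IsFiniteMeasure (dagumMixture lam δ) := by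
  refine ⟨lt_of_le_of_lt ?_ ENNReal.one_lt_top⟩
  have hr : Tendsto (fun n : ℕ => 1 / ((n : ℝ) + 1)) atTop (𝓝 0) :=
    tendsto_one_div_add_atTop_nhds_zero_nat
  calc dagumMixture lam δ univ = ∫⁻ _, 1 ∂dagumMixture lam δ := lintegral_one.symm
    _ = ∫⁻ s, liminf (fun n : ℕ => ENNReal.ofReal (exp (-(s * (1 / ((n : ℝ) + 1)) ^ 2)))) atTop
        ∂dagumMixture lam δ := by
        congr 1
        ext s
        have : Tendsto (fun n : ℕ => ENNReal.ofReal (exp (-(s * (1 / ((n : ℝ) + 1)) ^ 2)))) atTop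
            (𝓝 (ENNReal.ofReal (exp (-(s * 0 ^ 2))))) :=
          ENNReal.tendsto_ofReal ((continuous_exp.tendsto _).comp (((hr.pow 2).const_mul s).neg))
        rw [this.liminf_eq]
        simp
    _ ≤ liminf (fun n : ℕ => ∫⁻ s, ENNReal.ofReal (exp (-(s * (1 / ((n : ℝ) + 1)) ^ 2)))
        ∂dagumMixture lam δ) atTop := lintegral_liminf_le fun n => by fun_prop
    _ ≤ liminf (fun _ : ℕ => (1 : ENNReal)) atTop := by
        refine liminf_le_liminf (Eventually.of_forall fun n => ?_)
        have hn : 0 < 1 / ((n : ℝ) + 1) := by positivity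
        rw [lintegral_exp_dagumMixture hδ hlam hn]
        exact ENNReal.ofReal_le_one.2 (dagum_le_one lam δ hn.le)
    _ = 1 := liminf_const 1

theorem dagum_eq_integral_dagumMixture (hδ : δ ∈ Ioo (0 : ℝ) 2) (hlam : δ * lam ∈ Ioc (0 : ℝ) 2)
    {r : ℝ} (hr : 0 < r) : dagum lam δ r = ∫ s, exp (-(s * r ^ 2)) ∂dagumMixture lam δ := by
  have hD : 0 ≤ dagum lam δ r := by
    have h := (dagum_eq_integral_dagumBoundary hδ hlam hr).2
    have h0 : 0 ≤ ∫ t in Ioi (0 : ℝ), t * dagumBoundary lam δ t / (t ^ 2 + r ^ 2) :=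
      setIntegral_nonneg measurableSet_Ioi fun t ht => by
        have ht' : (0 : ℝ) < t := ht
        have := dagumBoundary_nonneg hδ hlam t
        positivity
    rw [h] at h0
    exact nonneg_of_mul_nonneg_right h0 (by positivity)
  rw [integral_eq_lintegral_of_nonneg_ae (ae_of_all _ fun s => (exp_pos _).le) (by fun_prop),
    lintegral_exp_dagumMixture hδ hlam hr, ENNReal.toReal_ofReal hD]

/-- The minus sign makes the left integrand nonnegative, so both sides become integrals in
$[0,\infty]$ and Tonelli reduces the claim to a pointwise identity in $t$. -/
theorem integral_heatKernel_dagumMixture {d : ℕ} (hd : 0 < d) (hδ : δ ∈ Ioo (0 : ℝ) 2)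
    (hlam : δ * lam ∈ Ioc (0 : ℝ) 2) {z : ℝ} (hz : 0 < z) :
    -(z ^ (1 - (d : ℝ) / 2) / (2 ^ ((d : ℝ) / 2 - 1) * π ^ ((d : ℝ) / 2 + 1))) *
      (∫ t in Ioi (0 : ℝ), rotatedIntegrand d lam δ z t).im =
      ∫ s, heatKernel d s z ∂dagumMixture lam δ := by
  have hlam0 : 0 < lam := pos_of_mul_pos_right hlam.1 hδ.1.le
  have hint := integrableOn_rotatedIntegrand (lam := lam) hd hδ hlam0 hz
  have hmK : Measurable fun s => heatKernel d s z :=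
    (measurable_heatKernel d).comp (f := fun s : ℝ => (s, z)) (by fun_prop)
  set A := z ^ (1 - (d : ℝ) / 2) / (2 ^ ((d : ℝ) / 2 - 1) * π ^ ((d : ℝ) / 2 + 1)) with hA
  have him : (∫ t in Ioi (0 : ℝ), rotatedIntegrand d lam δ z t).im =
      ∫ t in Ioi (0 : ℝ), (rotatedIntegrand d lam δ z t).im :=
    (Complex.imCLM.integral_comp_comm hint).symm
  have hinner : ∀ t ∈ Ioi (0 : ℝ), ∫⁻ s in Ioi (0 : ℝ), ENNReal.ofReal (exp (-(s * t ^ 2))) *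
      ENNReal.ofReal (heatKernel d s z) = ENNReal.ofReal ((2 * π) ^ (-((d : ℝ) / 2)) *
      (t / z) ^ ((d : ℝ) / 2 - 1) * besselK ((d : ℝ) / 2 - 1) (z * t)) := fun t ht => by
    rw [← integral_exp_mul_heatKernel hd hz ht, ofReal_integral_eq_lintegral_ofReal
      (integrableOn_exp_mul_heatKernel hd hz ht) ((ae_restrict_iff' measurableSet_Ioi).2
        (ae_of_all _ fun s hs => mul_nonneg (exp_pos _).le (heatKernel_nonneg d (le_of_lt hs) z)))]
    simp only [ENNReal.ofReal_mul (exp_pos _).le]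
  have hpt : ∀ t ∈ Ioi (0 : ℝ), -A * (rotatedIntegrand d lam δ z t).im =
      2 / π * (t * dagumBoundary lam δ t) * ((2 * π) ^ (-((d : ℝ) / 2)) *
        (t / z) ^ ((d : ℝ) / 2 - 1) * besselK ((d : ℝ) / 2 - 1) (z * t)) := fun t ht => by
    have ht' : (0 : ℝ) < t := ht
    rw [rotatedIntegrand_im hδ ht, hA, rpow_neg (by positivity), div_rpow ht'.le hz.le,
      rpow_sub_one ht'.ne', show 1 - (d : ℝ) / 2 = -((d : ℝ) / 2 - 1) by ring, rpow_neg hz.le,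
      rpow_sub_one two_ne_zero, rpow_add_one pi_ne_zero, mul_rpow two_pos.le pi_pos.le]
    have := pi_ne_zero
    have h1 : z ^ ((d : ℝ) / 2 - 1) ≠ 0 := by positivity
    have h2 : (2 : ℝ) ^ ((d : ℝ) / 2) ≠ 0 := by positivity
    have h3 : π ^ ((d : ℝ) / 2) ≠ 0 := by positivity
    field_simp
  have hw0 : ∀ t ∈ Ioi (0 : ℝ), 0 ≤ 2 / π * (t * dagumBoundary lam δ t) := fun t ht => by
    have ht' : (0 : ℝ) < t := ht
    have := dagumBoundary_nonneg hδ hlam t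
    positivity
  have hK0 : ∀ t ∈ Ioi (0 : ℝ), 0 ≤ (2 * π) ^ (-((d : ℝ) / 2)) *
      (t / z) ^ ((d : ℝ) / 2 - 1) * besselK ((d : ℝ) / 2 - 1) (z * t) := fun t ht => by
    rw [← integral_exp_mul_heatKernel hd hz ht]
    exact setIntegral_nonneg measurableSet_Ioi fun s hs =>
      mul_nonneg (exp_pos _).le (heatKernel_nonneg d (le_of_lt hs) z)
  rw [him, ← integral_const_mul]
  rw [integral_eq_lintegral_of_nonneg_ae ((ae_restrict_iff' measurableSet_Ioi).2
      (ae_of_all _ fun t ht => (hpt t ht).symm ▸ mul_nonneg (hw0 t ht) (hK0 t ht)))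
      ((Complex.continuous_im.comp_aestronglyMeasurable hint.1).const_mul _),
    integral_eq_lintegral_of_nonneg_ae ((ae_dagumMixture_pos lam δ).mono fun s hs =>
      heatKernel_nonneg d hs.le z) hmK.aestronglyMeasurable,
    lintegral_dagumMixture hδ hmK.ennreal_ofReal]
  congr 1
  refine setLIntegral_congr_fun measurableSet_Ioi fun t ht => ?_
  rw [hinner t ht, hpt t ht, dagumWeight, ENNReal.ofReal_mul (hw0 t ht)]

end DagumMixture

theorem theorem2 (d : ℕ) (hd : 1 < d) (δ lam : ℝ) (hδ : δ ∈ Set.Ioo (0 : ℝ) 2)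
    (hlam : δ * lam ∈ Set.Ioc (0 : ℝ) 2) :
    (∀ z : ℝ, 0 < z → IntegrableOn (rotatedIntegrand d lam δ z) (Set.Ioi 0)) ∧
    IsIsotropicSpectralDensity d (dagum lam δ) (fun z : ℝ =>
      -(z ^ (1 - (d : ℝ) / 2) / (2 ^ ((d : ℝ) / 2 - 1) * π ^ ((d : ℝ) / 2 + 1))) *
        (∫ t in Set.Ioi (0 : ℝ), rotatedIntegrand d lam δ z t).im) := by
  have hd0 : 0 < d := by omega
  have := isFiniteMeasure_dagumMixture hδ hlam
  exact ⟨fun z hz => integrableOn_rotatedIntegrand hd0 hδ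
      (pos_of_mul_pos_right hlam.1 hδ.1.le) hz,
    isIsotropicSpectralDensity_of_mixture (ae_dagumMixture_pos lam δ) hd
      (fun r hr => dagum_eq_integral_dagumMixture hδ hlam hr)
      fun z hz => integral_heatKernel_dagumMixture hd0 hδ hlam hz⟩
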